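/- Fix $0<\delta<1$ and $1/2\le\sigma<1$. For $t>1$ let $\lambda_c=\dfrac{t^{\delta-1}}{1-t^{\delta-1}}$, let $\lambda=\lambda_c(1+\Lambda)$, and suppose that $\lambda$ lies in the range $$\lambda_c\le\lambda\le t^{1-\delta}-1 .$$ Let the angle $\phi$ satisfy $0<\phi<\pi/2$ if $\ln\lambda\ge0$, and $0<\phi<\arctan(\pi/|\ln\lambda|)$ if $\ln\lambda<0$. With principal branches of all logarithms and powers, and with contours that are the rays in the indicated direction, let $$J_B(t;\lambda)=\int_{1-t^{\delta-1}}^{\infty e^{i\phi}}(1-z)^{-1/2}z^{\sigma-1/2}\exp\big(it[(1-z)\ln(1-z)+z\ln z+z\ln\lambda]\big)\,dz,$$ $$\widetilde J_B(t;\Lambda)=\int_0^{\infty e^{i\phi}}(1-\zeta)^{-1/2}(1+\lambda_c\zeta)^{\sigma-1/2}\exp\Big(\frac{it f_1(\zeta)}{1+\lambda_c}\Big)\,d\zeta,$$ where $$f_1(\zeta)=\lambda_c\zeta\big[\ln(1+\Lambda)+\ln(1+\lambda_c\zeta)-\ln(1-\zeta)\big]+\ln(1+\lambda_c\zeta)+\lambda_c\ln(1-\zeta).$$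 Let $f_0=\ln\dfrac{\lambda_c(1+\Lambda)}{1+\lambda_c}-\lambda_c\ln\dfrac{1+\lambda_c}{\lambda_c}$ and $\omega=\omega(t,\Lambda)=\sqrt{\dfrac{\lambda_c t}{2}}\,\dfrac{\ln(1+\Lambda)}{1+\lambda_c}$. Theorem 1. For all such $t,\Lambda,\phi$ the integrals $J_B$ and $\widetilde J_B$ converge absolutely, as does $\int_w^{\infty e^{i\pi/4}}e^{i\xi^2}d\xi$ for every $w\ge0$. Moreover $\omega\ge 0$, and $$J_B(t;\lambda)=\Big(\frac{\lambda_c}{1+\lambda_c}\Big)^{1/2}\Big(\frac1{1+\lambda_c}\Big)^{\sigma-1/2}\exp\Big(\frac{it f_0}{1+\lambda_c}\Big)\,\widetilde J_B(t;\Lambda).$$ As $t\to\infty$, $$\widetilde J_B(t;\Lambda)=e^{-i\omega^2}\sqrt{\frac{2}{\lambda_c t}}\Big(\int_\omega^{\infty e^{i\pi/4}}e^{i\xi^2}\,d\xi\Big)\,(1+o(1)),$$ where the $o(1)$ is uniform in $\Lambda$ over the whole range (and in $\phi$). Inserting this in the preceding relation gives the leading-order asymptotics of $J_B$, with the same uniformity.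 The integral $\int_\omega^{\infty e^{i\pi/4}}e^{i\xi^2}d\xi$ is bounded uniformly in $t$ and $\Lambda$; in particular it is $O(1)$ when $\omega=O(1)$. There are constants $C$ and $W>0$, independent of $t$ and $\Lambda$, such that whenever $\omega\ge W$ $$\Big|e^{-i\omega^2}\int_\omega^{\infty e^{i\pi/4}}e^{i\xi^2}\,d\xi+\frac{1}{2i\omega}\Big|\le\frac{C}{\omega^3},$$ and, as $t\to\infty$, $$\widetilde J_B(t;\Lambda)=\sqrt{\frac{2}{\lambda_c t}}\Big(-\frac1{2i\omega}+r\Big)(1+o(1)),\qquad |r|\le\frac{C}{\omega^{3}},$$ where the $o(1)$ is uniform in $\phi$ and in all $\Lambda$ of the range with $\omega\ge W$. In particular this holds along every choice of $\Lambda=\Lambda(t)$ with $\omega\to\infty$. -/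

import Mathlib

noncomputable section

namespace UniformJB

open Set

/-- The point `a + r e^{iφ}` at distance `r` from `a` on the ray of direction `φ`. -/
def rayPoint (a : ℂ) (φ r : ℝ) : ℂ := a + (r : ℂ) * Complex.exp (Complex.I * (φ : ℂ))

/-- The contour integral `∫_a^{∞ e^{iφ}} f(z) dz`, taken along the ray from `a` of direction `φ`. -/
def rayIntegral (f : ℂ → ℂ) (a : ℂ) (φ : ℝ) : ℂ :=
  ∫ r in Ioi (0 : ℝ), f (rayPoint a φ r) * Complex.exp (Complex.I * (φ : ℂ))

/-- Absolute convergence of `∫_a^{∞ e^{iφ}} f(z) dz` along the ray from `a` of direction `φ`. -/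
def RayIntegrable (f : ℂ → ℂ) (a : ℂ) (φ : ℝ) : Prop :=
  MeasureTheory.IntegrableOn
    (fun r : ℝ => f (rayPoint a φ r) * Complex.exp (Complex.I * (φ : ℂ))) (Ioi (0 : ℝ))

/-- `λ_c = t^{δ-1} / (1 - t^{δ-1})`. -/
def lamC (δ t : ℝ) : ℝ := t ^ (δ - 1) / (1 - t ^ (δ - 1))

/-- The admissible values of `λ`: `λ_c ≤ λ ≤ t^{1-δ} - 1`. -/
def lamRange (δ t : ℝ) : Set ℝ := Icc (lamC δ t) (t ^ (1 - δ) - 1)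

/-- The admissible directions `φ` of the contour of integration. -/
def AdmissibleAngle (lam φ : ℝ) : Prop :=
  (0 ≤ Real.log lam ∧ 0 < φ ∧ φ < Real.pi / 2) ∨
  (Real.log lam < 0 ∧ 0 < φ ∧ φ < Real.arctan (Real.pi / |Real.log lam|))

/-- `F(z; λ) = (1-z) ln(1-z) + z ln z + z ln λ`, with principal logarithms. -/
def phaseF (lam : ℝ) (z : ℂ) : ℂ :=
  (1 - z) * Complex.log (1 - z) + z * Complex.log z + z * (Real.log lam : ℂ)

/-- The integrand `(1-z)^{-1/2} z^{σ-1/2} exp(i t F(z; λ))` of `J_B`. -/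
def integrandJB (σ t lam : ℝ) (z : ℂ) : ℂ :=
  (1 - z) ^ (-(1 / 2) : ℂ) * z ^ ((σ : ℂ) - 1 / 2) *
    Complex.exp (Complex.I * (t : ℂ) * phaseF lam z)

/-- `J_B(t; λ)`, computed along the ray of direction `φ` that starts at `1 - t^{δ-1}`. -/
def JB (δ σ t lam φ : ℝ) : ℂ :=
  rayIntegral (integrandJB σ t lam) ((1 - t ^ (δ - 1) : ℝ) : ℂ) φ

/-- `f_0(Λ, λ_c)`. -/
def f0 (Lam lc : ℝ) : ℝ :=
  Real.log (lc * (1 + Lam) / (1 + lc)) - lc * Real.log ((1 + lc) / lc)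

/-- `f_1(ζ; t, Λ)`, as a function of `ζ`, `Λ` and `lc = λ_c`. -/
def f1 (lc Lam : ℝ) (ζ : ℂ) : ℂ :=
  (lc : ℂ) * ζ * ((Real.log (1 + Lam) : ℂ) + Complex.log (1 + (lc : ℂ) * ζ) - Complex.log (1 - ζ))
    + Complex.log (1 + (lc : ℂ) * ζ) + (lc : ℂ) * Complex.log (1 - ζ)

/-- `h(ζ; t, Λ) = f_1(ζ; t, Λ) / (1 + λ_c)`. -/
def phaseH (δ t Lam : ℝ) (ζ : ℂ) : ℂ := f1 (lamC δ t) Lam ζ / (1 + (lamC δ t : ℂ))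

/-- `g(ζ; t) = (1-ζ)^{-1/2} (1 + λ_c ζ)^{σ-1/2}`. -/
def ampG (δ σ t : ℝ) (ζ : ℂ) : ℂ :=
  (1 - ζ) ^ (-(1 / 2) : ℂ) * (1 + (lamC δ t : ℂ) * ζ) ^ ((σ : ℂ) - 1 / 2)

/-- The integrand `g(ζ; t) exp(i t h(ζ; t, Λ))` of the reduced integral. -/
def integrandTilde (δ σ t Lam : ℝ) (ζ : ℂ) : ℂ :=
  ampG δ σ t ζ * Complex.exp (Complex.I * (t : ℂ) * phaseH δ t Lam ζ)

/-- The reduced integral `J̃_B(t; Λ)`, computed along the ray of direction `φ` from `0`. -/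
def JBtilde (δ σ t Lam φ : ℝ) : ℂ := rayIntegral (integrandTilde δ σ t Lam) 0 φ

/-- The explicit factor that relates `J_B` to `J̃_B`. -/
def prefactor (δ σ t Lam : ℝ) : ℂ :=
  (((lamC δ t / (1 + lamC δ t)) ^ (1 / 2 : ℝ) * (1 / (1 + lamC δ t)) ^ (σ - 1 / 2) : ℝ) : ℂ) *
    Complex.exp (Complex.I * (t : ℂ) * (f0 Lam (lamC δ t) : ℂ) / (1 + (lamC δ t : ℂ)))

/-- `ω(t, Λ) = √(λ_c t / 2) · ln(1+Λ) / (1+λ_c)`. -/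
def omega (δ t Lam : ℝ) : ℝ :=
  Real.sqrt (lamC δ t * t / 2) * (Real.log (1 + Lam) / (1 + lamC δ t))

/-- The integrand `e^{iξ²}`. -/
def fresnelIntegrand (ξ : ℂ) : ℂ := Complex.exp (Complex.I * ξ ^ 2)

/-- The Fresnel-type integral `∫_w^{∞ e^{iπ/4}} e^{iξ²} dξ`. -/
def fresnel (w : ℝ) : ℂ := rayIntegral fresnelIntegrand (w : ℂ) (Real.pi / 4)

/-- The leading term `e^{-iω²} √(2/(λ_c t)) ∫_ω^{∞ e^{iπ/4}} e^{iξ²} dξ`. -/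
def leadingTerm (δ t Lam : ℝ) : ℂ :=
  Complex.exp (-Complex.I * (omega δ t Lam : ℂ) ^ 2) * (Real.sqrt (2 / (lamC δ t * t)) : ℂ) *
    fresnel (omega δ t Lam)

end UniformJB

end

open UniformJB

namespace UniformJB

open Set Filter Topology MeasureTheory

/-! Near `ζ = 0` the phase `t f₁/(1+λ_c)` equals `N ζ² + 2√N ω ζ + O(N ζ³)` with `N = λ_c t / 2`,
and the amplitude is `1 + O(ζ)`. Completing the square in this model gives exactly the leading term.
Since `N ≥ t^δ / 2` tends to infinity, the integral concentrates at scale `N^{-1/2}`. The exact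
relation between the two integrals is the affine substitution `z = (1 - t^{δ-1})(1 + λ_c ζ)`.

Uniformity needs three ingredients.

Direction: for `λ` near `λ_c` the admissible sector has opening of order `1/|ln λ_c|`, so it closes
up as `t → ∞`. By Cauchy's theorem the ray can be moved to one angle, with tangent `1/(4|ln λ_c|)`,
that is admissible for the whole range (`exists_uniform_angle`, `JBtilde_eq_of_admissible`). Each
inverse power of its sine costs only a factor of order `ln t`.

Size of the leading term: it decays like `1/ω`, so a relative error requires a lower bound of order
`1/(1+ω)` for the Fresnel integral. A Gaussian averaging formula with positive real part supplies it
(`exists_norm_fresnel_ge`).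

Size of the error: along the chosen ray the integrand and its model obey the same bound
`exp(-decayRate)`, which contains `exp(-2ω x sin φ)`. That factor yields the matching `1/(1+ω)` in
the error (`one_add_mul_exp_neg_decayRate_le`). The relative error is then `O((sin φ)^{-6} N^{-1/2})
= O((ln t)^6 t^{-δ/2})`. -/

/-! ### Rays and rotation of contours. -/

theorem rayPoint_zero_eq (φ r : ℝ) :
    rayPoint 0 φ r = (r : ℂ) * Complex.exp (Complex.I * (φ : ℂ)) := by
  simp [rayPoint]

theorem norm_exp_I_mul (φ : ℝ) : ‖Complex.exp (Complex.I * (φ : ℂ))‖ = 1 := by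
  rw [mul_comm]; exact Complex.norm_exp_ofReal_mul_I φ

theorem norm_rayPoint_zero (φ : ℝ) {r : ℝ} (hr : 0 ≤ r) : ‖rayPoint 0 φ r‖ = r := by
  rw [rayPoint_zero_eq, norm_mul, norm_exp_I_mul, mul_one, Complex.norm_real, Real.norm_of_nonneg hr]

theorem continuous_rayPoint (a : ℂ) (φ : ℝ) : Continuous (rayPoint a φ) := by
  unfold rayPoint; fun_prop

theorem rayPoint_re (φ r : ℝ) : (rayPoint 0 φ r).re = r * Real.cos φ := by
  rw [rayPoint_zero_eq, mul_comm Complex.I, Complex.re_ofReal_mul, Complex.exp_ofReal_mul_I_re]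

theorem rayPoint_im (φ r : ℝ) : (rayPoint 0 φ r).im = r * Real.sin φ := by
  rw [rayPoint_zero_eq, mul_comm Complex.I, Complex.im_ofReal_mul, Complex.exp_ofReal_mul_I_im]

/-- Absolute convergence of a ray integral of a continuous function with exponential decay. -/
theorem rayIntegrable_of_exp_decay {f : ℂ → ℂ} {a : ℂ} {φ K c R : ℝ} (hc : 0 < c)
    (hf : ∀ r : ℝ, 0 ≤ r → ContinuousAt f (rayPoint a φ r))
    (hK : ∀ r : ℝ, R ≤ r → ‖f (rayPoint a φ r)‖ ≤ K * Real.exp (-c * r)) :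
    RayIntegrable f a φ := by
  have hcont : ContinuousOn
      (fun r : ℝ => f (rayPoint a φ r) * Complex.exp (Complex.I * (φ : ℂ))) (Ici 0) := by
    intro r hr
    have h1 : ContinuousAt (fun r : ℝ => f (rayPoint a φ r)) r :=
      ContinuousAt.comp (hf r hr) (continuous_rayPoint a φ).continuousAt
    exact (h1.mul continuousAt_const).continuousWithinAt
  have h := integrable_of_isBigO_exp_neg (f := fun r : ℝ =>
    ‖f (rayPoint a φ r) * Complex.exp (Complex.I * (φ : ℂ))‖) hc hcont.norm
    (Asymptotics.IsBigO.of_bound K ((eventually_ge_atTop R).mono fun r hr => by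
      rw [norm_norm, norm_mul, norm_exp_I_mul, mul_one, Real.norm_of_nonneg (Real.exp_nonneg _)]
      exact hK r hr))
  exact (integrable_norm_iff
    ((hcont.mono Ioi_subset_Ici_self).aestronglyMeasurable measurableSet_Ioi)).1 h

/-- The substitution `r = e^x`; it lets a sector be treated as a horizontal strip when contours are
rotated. -/
theorem integral_comp_exp_mul_exp {F : ℝ → ℂ} (hF : IntegrableOn F (Ioi 0)) :
    Integrable (fun x : ℝ => F (Real.exp x) * (Real.exp x : ℂ)) ∧
      ∫ x : ℝ, F (Real.exp x) * (Real.exp x : ℂ) = ∫ r in Ioi (0 : ℝ), F r := by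
  have him : Real.exp '' univ = Ioi (0 : ℝ) := by rw [image_univ, Real.range_exp]
  have hder : ∀ x ∈ (univ : Set ℝ), HasDerivWithinAt Real.exp (Real.exp x) univ x :=
    fun x _ => (Real.hasDerivAt_exp x).hasDerivWithinAt
  have hfun : (fun x : ℝ => F (Real.exp x) * (Real.exp x : ℂ)) =
      fun x : ℝ => |Real.exp x| • F (Real.exp x) := by
    funext x
    rw [abs_of_pos (Real.exp_pos x), Complex.real_smul, mul_comm]
  rw [hfun]
  constructor
  · rw [← integrableOn_univ]
    rw [← integrableOn_image_iff_integrableOn_abs_deriv_smul MeasurableSet.univ hder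
      Real.exp_injective.injOn, him]
    exact hF
  · rw [← setIntegral_univ, ← integral_image_eq_integral_abs_deriv_smul MeasurableSet.univ hder
      Real.exp_injective.injOn, him]

/-- Rotation of the contour: the integral of a holomorphic function with exponential decay in a
sector does not depend on the direction of the ray. -/
theorem rayIntegral_eq_of_exp_decay {f : ℂ → ℂ} {φ₁ φ₂ K c R : ℝ} (hφ : φ₁ ≤ φ₂) (hc : 0 < c)
    (hd : ∀ r : ℝ, 0 < r → ∀ θ ∈ Icc φ₁ φ₂, DifferentiableAt ℂ f (rayPoint 0 θ r))
    (h0 : ContinuousAt f 0)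
    (hK : ∀ r : ℝ, R ≤ r → ∀ θ ∈ Icc φ₁ φ₂, ‖f (rayPoint 0 θ r)‖ ≤ K * Real.exp (-c * r)) :
    rayIntegral f 0 φ₁ = rayIntegral f 0 φ₂ := by
  have hint : ∀ θ ∈ Icc φ₁ φ₂, RayIntegrable f 0 θ := fun θ hθ => by
    refine rayIntegrable_of_exp_decay hc (fun r hr => ?_) (fun r hr => hK r hr θ hθ)
    rcases hr.eq_or_lt with rfl | hr
    · simpa [rayPoint] using h0
    · exact (hd r hr θ hθ).continuousAt
  -- In the coordinate `ζ = e^w` the sector is the strip `φ₁ ≤ Im w ≤ φ₂`, and Cauchy's theorem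
  -- applies to rectangles. The right side vanishes by the decay of `f`; the left side vanishes
  -- because `f` is bounded near `0` and `|e^w|` tends to `0` there.
  set g : ℂ → ℂ := fun w => f (Complex.exp w) * Complex.exp w with hg
  have hexp : ∀ x θ : ℝ, Complex.exp (x + θ * Complex.I) = rayPoint 0 θ (Real.exp x) := by
    intro x θ
    rw [rayPoint_zero_eq, Complex.exp_add, Complex.ofReal_exp, mul_comm Complex.I]
  have hline : ∀ θ ∈ Icc φ₁ φ₂, Tendsto
      (fun n : ℝ => ∫ x in (-n)..n, g (x + θ * Complex.I)) atTop (𝓝 (rayIntegral f 0 θ)) := by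
    intro θ hθ
    obtain ⟨h1, h2⟩ := integral_comp_exp_mul_exp (hint θ hθ)
    have hfun : (fun x : ℝ => g (x + θ * Complex.I)) = fun x : ℝ =>
        f (rayPoint 0 θ (Real.exp x)) * Complex.exp (Complex.I * (θ : ℂ)) * (Real.exp x : ℂ) := by
      funext x
      rw [hg]
      simp only [hexp]
      nth_rewrite 2 [rayPoint_zero_eq]
      ring
    rw [rayIntegral, ← h2]
    have h3 := intervalIntegral_tendsto_integral h1 tendsto_neg_atTop_atBot tendsto_id
    simp only [← hfun] at h3 ⊢
    exact h3
  have hnorm : ∀ x θ : ℝ, ‖g (x + θ * Complex.I)‖ =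
      ‖f (rayPoint 0 θ (Real.exp x))‖ * Real.exp x := by
    intro x θ
    rw [hg]
    simp only [hexp]
    rw [norm_mul, norm_rayPoint_zero _ (Real.exp_pos x).le]
  have hright : Tendsto (fun n : ℝ => ∫ y in φ₁..φ₂, g ((n : ℂ) + y * Complex.I)) atTop (𝓝 0) := by
    have hlim : Tendsto (fun n : ℝ => K * (Real.exp n ^ (1 : ℝ) * Real.exp (-c * Real.exp n)) *
        |φ₂ - φ₁|) atTop (𝓝 0) := by
      have := (((tendsto_rpow_mul_exp_neg_mul_atTop_nhds_zero 1 c hc).comp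
        Real.tendsto_exp_atTop).const_mul K).mul_const |φ₂ - φ₁|
      simpa using this
    refine squeeze_zero_norm' ?_ hlim
    filter_upwards [Real.tendsto_exp_atTop.eventually_ge_atTop R] with n hn
    refine intervalIntegral.norm_integral_le_of_norm_le_const fun y hy => ?_
    rw [uIoc_of_le hφ] at hy
    rw [hnorm, Real.rpow_one]
    have := mul_le_mul_of_nonneg_right (hK _ hn y ⟨hy.1.le, hy.2⟩) (Real.exp_pos n).le
    linarith
  have hleft : Tendsto (fun n : ℝ => ∫ y in φ₁..φ₂, g (((-n : ℝ) : ℂ) + y * Complex.I)) atTop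
      (𝓝 0) := by
    have hbd : ∀ᶠ z in 𝓝 (0 : ℂ), ‖f z‖ < ‖f 0‖ + 1 :=
      h0.norm.eventually_lt continuousAt_const (by linarith)
    obtain ⟨ε, hε, hball⟩ := Metric.eventually_nhds_iff.1 hbd
    have hexp0 : Tendsto (fun n : ℝ => Real.exp (-n)) atTop (𝓝 0) :=
      Real.tendsto_exp_neg_atTop_nhds_zero
    have hlim : Tendsto (fun n : ℝ => (‖f 0‖ + 1) * Real.exp (-n) * |φ₂ - φ₁|) atTop (𝓝 0) := by
      simpa using (hexp0.const_mul (‖f 0‖ + 1)).mul_const |φ₂ - φ₁|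
    refine squeeze_zero_norm' ?_ hlim
    filter_upwards [hexp0.eventually_lt_const hε] with n hn
    refine intervalIntegral.norm_integral_le_of_norm_le_const fun y hy => ?_
    rw [hnorm]
    refine mul_le_mul_of_nonneg_right (hball ?_).le (Real.exp_pos _).le
    rwa [dist_zero_right, norm_rayPoint_zero _ (Real.exp_pos _).le]
  have hrect : ∀ n : ℝ, ((∫ x in (-n)..n, g (x + φ₁ * Complex.I)) -
      ∫ x in (-n)..n, g (x + φ₂ * Complex.I)) +
      Complex.I • (∫ y in φ₁..φ₂, g ((n : ℂ) + y * Complex.I)) -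
      Complex.I • (∫ y in φ₁..φ₂, g (((-n : ℝ) : ℂ) + y * Complex.I)) = 0 := by
    intro n
    have := Complex.integral_boundary_rect_eq_zero_of_differentiableOn g
      (((-n : ℝ) : ℂ) + φ₁ * Complex.I) ((n : ℂ) + φ₂ * Complex.I) ?_
    · simpa using this
    · intro w hw
      have hw2 : w.im ∈ Icc φ₁ φ₂ := by
        have := hw.2
        simpa [uIcc_of_le hφ] using this
      have hdw : DifferentiableAt ℂ f (Complex.exp w) := by
        have : Complex.exp w = rayPoint 0 w.im (Real.exp w.re) := by
          rw [← hexp, Complex.re_add_im]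
        rw [this]
        exact hd _ (Real.exp_pos _) _ hw2
      exact ((hdw.comp w Complex.differentiableAt_exp).mul
        Complex.differentiableAt_exp).differentiableWithinAt
  have hlim := (((hline φ₁ ⟨le_rfl, hφ⟩).sub (hline φ₂ ⟨hφ, le_rfl⟩)).add
    (hright.const_smul Complex.I)).sub (hleft.const_smul Complex.I)
  have h := tendsto_nhds_unique hlim (tendsto_const_nhds.congr fun n => (hrect n).symm)
  simpa [sub_eq_zero] using h

/-! ### The half-line Gaussian integral: upper bound, expansion, lower bound. -/

/-- The half-line Gaussian integral `∫_0^∞ e^{-s² - 2as} ds`. -/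
noncomputable def halfGauss (a : ℂ) : ℂ := ∫ s in Ioi (0 : ℝ), Complex.exp (-(s : ℂ) ^ 2 - 2 * a * s)

theorem norm_halfGauss_integrand (a : ℂ) (s : ℝ) :
    ‖Complex.exp (-(s : ℂ) ^ 2 - 2 * a * s)‖ = Real.exp (-s ^ 2 - 2 * a.re * s) := by
  rw [Complex.norm_exp]
  congr 1
  simp [← Complex.ofReal_pow]

theorem integrable_exp_neg_sq_Ioi : IntegrableOn (fun s : ℝ => Real.exp (-s ^ 2)) (Ioi 0) := by
  have := (integrable_exp_neg_mul_sq (b := 1) one_pos).integrableOn (s := Ioi (0 : ℝ))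
  simpa using this

theorem norm_halfGauss_integrand_le {a : ℂ} (ha : 0 ≤ a.re) {s : ℝ} (hs : 0 ≤ s) :
    ‖Complex.exp (-(s : ℂ) ^ 2 - 2 * a * s)‖ ≤ Real.exp (-s ^ 2) := by
  rw [norm_halfGauss_integrand]
  gcongr
  nlinarith [mul_nonneg ha hs]

theorem integrable_halfGauss {a : ℂ} (ha : 0 ≤ a.re) :
    IntegrableOn (fun s : ℝ => Complex.exp (-(s : ℂ) ^ 2 - 2 * a * s)) (Ioi 0) := by
  refine integrable_exp_neg_sq_Ioi.mono' (by fun_prop) ?_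
  filter_upwards [ae_restrict_mem measurableSet_Ioi] with s hs
  exact norm_halfGauss_integrand_le ha (le_of_lt hs)

theorem norm_halfGauss_le {a : ℂ} (ha : 0 ≤ a.re) : ‖halfGauss a‖ ≤ Real.sqrt Real.pi / 2 := by
  have h := integral_gaussian_Ioi 1
  simp only [neg_mul, one_mul, div_one] at h
  rw [← h]
  refine norm_integral_le_of_norm_le integrable_exp_neg_sq_Ioi ?_
  filter_upwards [ae_restrict_mem measurableSet_Ioi] with s hs
  exact norm_halfGauss_integrand_le ha (le_of_lt hs)

theorem integral_pow_mul_exp_neg_mul_Ioi (n : ℕ) {b : ℝ} (hb : 0 < b) :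
    IntegrableOn (fun x : ℝ => x ^ n * Real.exp (-(b * x))) (Ioi 0) ∧
      ∫ x in Ioi (0 : ℝ), x ^ n * Real.exp (-(b * x)) = n.factorial / b ^ (n + 1) := by
  have h := Real.integral_rpow_mul_exp_neg_mul_Ioi (a := n + 1) (r := b) (by positivity) hb
  have h2 : ∫ x in Ioi (0 : ℝ), x ^ n * Real.exp (-(b * x)) = n.factorial / b ^ (n + 1) := by
    simp only [add_sub_cancel_right, Real.rpow_natCast] at h
    rw [h, Real.Gamma_nat_eq_factorial]
    rw [show ((n : ℝ) + 1) = ((n + 1 : ℕ) : ℝ) by push_cast; ring, Real.rpow_natCast]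
    simp [div_eq_mul_inv, mul_comm]
  refine ⟨?_, h2⟩
  -- A non-integrable function has integral `0` by convention, whereas the computed value is
  -- positive.
  by_contra hni
  rw [integral_undef hni] at h2
  have : (0 : ℝ) < n.factorial / b ^ (n + 1) := by positivity
  linarith

/-- Dropping `e^{-s²}` leaves `∫ e^{-2as} ds = 1/(2a)`; the error is controlled by `|e^{-s²} - 1| ≤
s²` and the second moment of `e^{-2 (Re a) s}`. -/
theorem norm_halfGauss_sub_le {a : ℂ} (ha : 0 < a.re) :
    ‖halfGauss a - 1 / (2 * a)‖ ≤ 1 / (4 * a.re ^ 3) := by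
  have ha0 : a ≠ 0 := fun h => by simp [h] at ha
  have hre : (-(2 * a)).re < 0 := by simpa using ha
  have h1 : ∫ s in Ioi (0 : ℝ), Complex.exp (-(2 * a) * s) = 1 / (2 * a) := by
    rw [integral_exp_mul_complex_Ioi hre]
    simp
  have hint : IntegrableOn (fun s : ℝ => Complex.exp (-(2 * a) * s)) (Ioi 0) :=
    integrableOn_exp_mul_complex_Ioi hre 0
  obtain ⟨hi, hv⟩ := integral_pow_mul_exp_neg_mul_Ioi 2 (b := 2 * a.re) (by positivity)
  rw [halfGauss, ← h1, ← integral_sub (integrable_halfGauss ha.le) hint]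
  have hval : (Nat.factorial 2 : ℝ) / (2 * a.re) ^ (2 + 1) = 1 / (4 * a.re ^ 3) := by
    simp only [Nat.factorial]; field_simp; push_cast; ring
  rw [← hval, ← hv]
  refine norm_integral_le_of_norm_le hi ?_
  filter_upwards [ae_restrict_mem measurableSet_Ioi] with s hs
  have hfac : Complex.exp (-(s : ℂ) ^ 2 - 2 * a * s) - Complex.exp (-(2 * a) * s) =
      ((Real.exp (-s ^ 2) - 1 : ℝ) : ℂ) * Complex.exp (-(2 * a) * s) := by
    push_cast
    rw [sub_mul, ← Complex.exp_add, one_mul]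
    congr 2; ring
  rw [hfac, norm_mul, Complex.norm_exp, Complex.norm_real]
  have hb : ‖Real.exp (-s ^ 2) - 1‖ ≤ s ^ 2 := by
    rw [Real.norm_eq_abs, abs_le]
    constructor
    · linarith [Real.add_one_le_exp (-s ^ 2)]
    · have : Real.exp (-s ^ 2) ≤ 1 := Real.exp_le_one_iff.2 (by nlinarith)
      nlinarith
  have he : (-(2 * a) * (s : ℂ)).re = -(2 * a.re * s) := by simp
  rw [he]
  gcongr

/-- The Gaussian average formula for the half-line Gaussian integral. -/
theorem halfGauss_eq_integral {a : ℂ} (ha : 0 < a.re) :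
    Integrable (fun x : ℝ => Complex.exp (-(x : ℂ) ^ 2) / (a - Complex.I * x)) ∧
    halfGauss a = (1 / (2 * (Real.sqrt Real.pi : ℂ))) *
      ∫ x : ℝ, Complex.exp (-(x : ℂ) ^ 2) / (a - Complex.I * x) := by
  have hpi : (Real.sqrt Real.pi : ℂ) ≠ 0 := by
    exact_mod_cast (Real.sqrt_pos.2 Real.pi_pos).ne'
  -- Write `e^{-s²}` as the Fourier transform of a Gaussian in `x` and exchange the integrals. The
  -- condition `Re a > 0` gives absolute convergence and makes the `s`-integral equal to `1/(2(a -
  -- ix))`.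
  set F : ℝ → ℝ → ℂ := fun s x =>
    Complex.exp (-(x : ℂ) ^ 2) * Complex.exp (-(2 * (a - Complex.I * x)) * s) with hF
  have hFn : ∀ s x : ℝ, ‖F s x‖ = Real.exp (-(2 * a.re * s)) * Real.exp (-1 * x ^ 2) := by
    intro s x
    rw [hF]
    simp only
    rw [norm_mul, Complex.norm_exp, Complex.norm_exp, mul_comm]
    congr 2
    · simp
    · simp [← Complex.ofReal_pow]
  have hFint : Integrable (Function.uncurry F)
      ((volume.restrict (Ioi (0 : ℝ))).prod (volume : Measure ℝ)) := by
    have h1 : Integrable (fun s : ℝ => Real.exp (-(2 * a.re * s))) (volume.restrict (Ioi 0)) := by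
      have := (integral_pow_mul_exp_neg_mul_Ioi 0 (b := 2 * a.re) (by positivity)).1
      simpa [IntegrableOn] using this
    refine (h1.mul_prod (integrable_exp_neg_mul_sq one_pos)).mono' ?_ ?_
    · apply Continuous.aestronglyMeasurable
      rw [hF]
      fun_prop
    · exact Eventually.of_forall fun p => (hFn p.1 p.2).le
  have hs : ∀ x : ℝ, ∫ s in Ioi (0 : ℝ), F s x =
      (1 / 2) * (Complex.exp (-(x : ℂ) ^ 2) / (a - Complex.I * x)) := by
    intro x
    have hre : (-(2 * (a - Complex.I * x))).re < 0 := by simpa using ha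
    have hne : a - Complex.I * x ≠ 0 := fun h => by rw [h] at hre; simp at hre
    rw [hF]
    simp only
    rw [integral_const_mul, integral_exp_mul_complex_Ioi hre]
    simp only [Complex.ofReal_zero, mul_zero, Complex.exp_zero]
    field_simp
  have hx : ∀ s : ℝ, ∫ x : ℝ, F s x =
      (Real.sqrt Real.pi : ℂ) * Complex.exp (-(s : ℂ) ^ 2 - 2 * a * s) := by
    intro s
    have h := fourierIntegral_gaussian (b := 1) (by simp) (2 * s : ℂ)
    have hfun : (fun x : ℝ => F s x) = fun x : ℝ => Complex.exp (-(2 * a * s)) *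
        (Complex.exp (Complex.I * (2 * s) * x) * Complex.exp (-1 * (x : ℂ) ^ 2)) := by
      funext x
      rw [hF]
      simp only
      rw [← Complex.exp_add, ← Complex.exp_add, ← Complex.exp_add]
      congr 1; ring
    rw [hfun, integral_const_mul, h]
    have hsq : ((Real.pi : ℂ) / 1) ^ (1 / 2 : ℂ) = (Real.sqrt Real.pi : ℂ) := by
      rw [div_one, Real.sqrt_eq_rpow, Complex.ofReal_cpow Real.pi_pos.le]
      norm_num
    rw [hsq, mul_left_comm, ← Complex.exp_add]
    congr 2; ring
  have hswap := integral_integral_swap hFint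
  simp only [hs, hx] at hswap
  rw [integral_const_mul, integral_const_mul] at hswap
  constructor
  · have := hFint.integral_prod_right
    simp only [Function.uncurry] at this
    simp only [hs] at this
    simpa using this.const_mul 2
  · change (Real.sqrt Real.pi : ℂ) * halfGauss a = _ at hswap
    rw [← mul_right_inj' hpi, hswap, ← mul_assoc]
    congr 1
    field_simp

/-- In the averaging formula the real part of the integrand is `e^{-x²} Re a / |a - ix|²`, which is
positive, so the integral may be cut down to `[0, m]`. No cancellation can occur. -/
theorem halfGauss_re_ge {a : ℂ} (ha : 0 < a.re) {m : ℝ} (hm0 : 0 ≤ m) (hm1 : m ≤ 1) :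
    1 / (2 * Real.sqrt Real.pi) * (m * (Real.exp (-1) * (a.re / (‖a‖ + m) ^ 2))) ≤
      (halfGauss a).re := by
  obtain ⟨hi, hv⟩ := halfGauss_eq_integral ha
  have hpt : ∀ x : ℝ, (Complex.exp (-(x : ℂ) ^ 2) / (a - Complex.I * x)).re =
      Real.exp (-x ^ 2) * (a.re / ‖a - Complex.I * x‖ ^ 2) := by
    intro x
    have h1 : Complex.exp (-(x : ℂ) ^ 2) = ((Real.exp (-x ^ 2) : ℝ) : ℂ) := by push_cast; rfl
    rw [h1, div_eq_mul_inv, Complex.re_ofReal_mul, Complex.inv_re, Complex.normSq_eq_norm_sq]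
    simp
  have hre : (halfGauss a).re = 1 / (2 * Real.sqrt Real.pi) *
      ∫ x : ℝ, Real.exp (-x ^ 2) * (a.re / ‖a - Complex.I * x‖ ^ 2) := by
    have h2 : (1 / (2 * (Real.sqrt Real.pi : ℂ))) = ((1 / (2 * Real.sqrt Real.pi) : ℝ) : ℂ) := by
      push_cast; rfl
    rw [hv, h2, Complex.re_ofReal_mul, ← integral_congr_ae (Eventually.of_forall hpt)]
    congr 1
    exact (integral_re hi).symm
  have hi' : Integrable fun x : ℝ => Real.exp (-x ^ 2) * (a.re / ‖a - Complex.I * x‖ ^ 2) :=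
    hi.re.congr (Eventually.of_forall hpt)
  rw [hre]
  refine mul_le_mul_of_nonneg_left ?_ (by positivity)
  have hset : ∫ x in Icc 0 m, Real.exp (-1) * (a.re / (‖a‖ + m) ^ 2) =
      m * (Real.exp (-1) * (a.re / (‖a‖ + m) ^ 2)) := by
    rw [setIntegral_const]
    simp [hm0]
  rw [← hset]
  refine (setIntegral_mono_on continuous_const.integrableOn_Icc hi'.integrableOn measurableSet_Icc ?_).trans
    (setIntegral_le_integral hi' (Eventually.of_forall fun x => by positivity))
  intro x hx
  have hne : 0 < ‖a - Complex.I * x‖ := norm_pos_iff.2 fun h => by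
    have : (a - Complex.I * x).re = 0 := by rw [h]; rfl
    simp at this; linarith
  have hle : ‖a - Complex.I * x‖ ≤ ‖a‖ + m := by
    refine (norm_sub_le _ _).trans ?_
    simp only [norm_mul, Complex.norm_I, Complex.norm_real, one_mul, Real.norm_eq_abs,
      abs_of_nonneg hx.1]
    linarith [hx.2]
  have hxx : -1 ≤ -x ^ 2 := by nlinarith [hx.1, hx.2]
  gcongr

/-! ### The Fresnel integral as a half-line Gaussian. -/

/-- The direction `e^{iπ/4}`. -/
noncomputable def diagDir : ℂ := Complex.exp (Complex.I * ((Real.pi / 4 : ℝ) : ℂ))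

/-- The direction `e^{-iπ/4}`. -/
noncomputable def antidiagDir : ℂ := Complex.exp (-(Complex.I * ((Real.pi / 4 : ℝ) : ℂ)))

theorem diagDir_sq : diagDir ^ 2 = Complex.I := by
  rw [diagDir, ← Complex.exp_nat_mul]
  have : ((2 : ℕ) : ℂ) * (Complex.I * ((Real.pi / 4 : ℝ) : ℂ)) = Real.pi / 2 * Complex.I := by
    push_cast; ring
  rw [this, Complex.exp_pi_div_two_mul_I]

theorem diagDir_mul_antidiagDir : diagDir * antidiagDir = 1 := by
  rw [diagDir, antidiagDir, ← Complex.exp_add, add_neg_cancel, Complex.exp_zero]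

theorem I_mul_diagDir : Complex.I * diagDir = -antidiagDir := by
  linear_combination antidiagDir * Complex.I_mul_I +
    (antidiagDir * Complex.I) * diagDir_sq - (Complex.I * diagDir) * diagDir_mul_antidiagDir

theorem norm_diagDir : ‖diagDir‖ = 1 := norm_exp_I_mul _

theorem norm_antidiagDir : ‖antidiagDir‖ = 1 := by
  have h := congrArg norm diagDir_mul_antidiagDir
  rwa [norm_mul, norm_diagDir, one_mul, norm_one] at h

theorem antidiagDir_re : antidiagDir.re = Real.sqrt 2 / 2 := by
  have : antidiagDir = Complex.exp (((-(Real.pi / 4) : ℝ) : ℂ) * Complex.I) := by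
    rw [antidiagDir]; push_cast; congr 1; ring
  rw [this, Complex.exp_ofReal_mul_I_re, Real.cos_neg, Real.cos_pi_div_four]

theorem antidiagDir_mul_re (w : ℝ) : ((w : ℂ) * antidiagDir).re = w * (Real.sqrt 2 / 2) := by
  rw [Complex.re_ofReal_mul, antidiagDir_re]

/-- Since `i (e^{iπ/4})² = -1`, the oscillation turns into Gaussian decay on the diagonal. The
Fresnel integral is thereby `halfGauss` at `w e^{-iπ/4}`, whose real part is nonnegative for `w ≥
0`. -/
theorem fresnelIntegrand_rayPoint (w s : ℝ) :
    fresnelIntegrand (rayPoint w (Real.pi / 4) s) =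
      Complex.exp (Complex.I * (w : ℂ) ^ 2) *
        Complex.exp (-(s : ℂ) ^ 2 - 2 * (w * antidiagDir) * s) := by
  rw [fresnelIntegrand, rayPoint, ← Complex.exp_add]
  congr 1
  change Complex.I * (w + s * diagDir) ^ 2 = _
  linear_combination (s : ℂ) ^ 2 * Complex.I_mul_I + (Complex.I * (s : ℂ) ^ 2) * diagDir_sq +
    (2 * w * s : ℂ) * I_mul_diagDir

theorem rayIntegrable_fresnel {w : ℝ} (hw : 0 ≤ w) :
    RayIntegrable fresnelIntegrand (w : ℂ) (Real.pi / 4) := by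
  rw [RayIntegrable]
  simp only [fresnelIntegrand_rayPoint]
  refine Integrable.mul_const ?_ _
  refine Integrable.const_mul ?_ _
  refine integrable_halfGauss ?_
  rw [antidiagDir_mul_re]
  positivity

theorem fresnel_eq (w : ℝ) :
    fresnel w = Complex.exp (Complex.I * (w : ℂ) ^ 2) * (diagDir * halfGauss (w * antidiagDir)) := by
  rw [fresnel, rayIntegral, halfGauss]
  simp only [fresnelIntegrand_rayPoint]
  rw [integral_mul_const, integral_const_mul]
  change _ * diagDir = _
  ring

theorem exp_mul_fresnel (w : ℝ) :
    Complex.exp (-Complex.I * (w : ℂ) ^ 2) * fresnel w = diagDir * halfGauss (w * antidiagDir) := by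
  rw [fresnel_eq, ← mul_assoc, ← Complex.exp_add]
  simp

theorem norm_exp_I_mul_sq (w : ℝ) : ‖Complex.exp (Complex.I * (w : ℂ) ^ 2)‖ = 1 := by
  rw [← Complex.ofReal_pow]; exact norm_exp_I_mul _

theorem norm_fresnel_eq (w : ℝ) : ‖fresnel w‖ = ‖halfGauss (w * antidiagDir)‖ := by
  rw [fresnel_eq, norm_mul, norm_mul, norm_exp_I_mul_sq, norm_diagDir, one_mul, one_mul]

theorem norm_fresnel_le {w : ℝ} (hw : 0 ≤ w) : ‖fresnel w‖ ≤ Real.sqrt Real.pi / 2 := by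
  rw [norm_fresnel_eq]
  refine norm_halfGauss_le ?_
  rw [antidiagDir_mul_re]
  positivity

/-- The large argument asymptotics of the Fresnel integral. -/
theorem norm_exp_mul_fresnel_sub_le {w : ℝ} (hw : 0 < w) :
    ‖Complex.exp (-Complex.I * (w : ℂ) ^ 2) * fresnel w - (-1 / (2 * Complex.I * (w : ℂ)))‖ ≤
      1 / w ^ 3 := by
  have hw0 : (w : ℂ) ≠ 0 := by exact_mod_cast hw.ne'
  have hre := antidiagDir_mul_re w
  have h2 : (0 : ℝ) < Real.sqrt 2 := by positivity
  have hpos : 0 < ((w : ℂ) * antidiagDir).re := by rw [hre]; positivity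
  have hdiag : -1 / (2 * Complex.I * (w : ℂ)) = diagDir * (1 / (2 * (w * antidiagDir))) := by
    have ha : antidiagDir ≠ 0 := norm_ne_zero_iff.1 (by rw [norm_antidiagDir]; exact one_ne_zero)
    field_simp
    linear_combination -I_mul_diagDir
  rw [exp_mul_fresnel, hdiag, ← mul_sub, norm_mul, norm_diagDir, one_mul]
  refine (norm_halfGauss_sub_le hpos).trans ?_
  rw [hre]
  have hs : Real.sqrt 2 ^ 2 = 2 := Real.sq_sqrt (by norm_num)
  have h1 : 1 ≤ Real.sqrt 2 := Real.one_le_sqrt.2 (by norm_num)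
  have heq : 4 * (w * (Real.sqrt 2 / 2)) ^ 3 = w ^ 3 * Real.sqrt 2 := by
    linear_combination (w ^ 3 * Real.sqrt 2 / 2) * hs
  rw [heq]
  refine one_div_le_one_div_of_le (by positivity) ?_
  nlinarith [pow_pos hw 3]

/-- The Fresnel integral is bounded below by a constant multiple of `1 / (1 + w)`. -/
theorem exists_norm_fresnel_ge : ∃ c : ℝ, 0 < c ∧ ∀ w : ℝ, 0 ≤ w → c / (1 + w) ≤ ‖fresnel w‖ := by
  -- The averaging formula needs `Re a > 0`, so `w = 0` is treated by the exact Gaussian value.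
  have h0 : 0 < ‖fresnel 0‖ := by
    rw [norm_fresnel_eq, norm_pos_iff, halfGauss]
    have := integral_gaussian_complex_Ioi (b := 1) (by simp)
    simp only [neg_mul, one_mul] at this
    simp only [Complex.ofReal_zero, zero_mul, mul_zero, sub_zero]
    rw [this, div_one]
    have hp : (Real.pi : ℂ) ≠ 0 := by exact_mod_cast Real.pi_ne_zero
    simp [Complex.cpow_eq_zero_iff, hp]
  set c : ℝ := 1 / (2 * Real.sqrt Real.pi) * (Real.exp (-1) * (Real.sqrt 2 / 2) / 4) with hc
  have hcpos : 0 < c := by positivity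
  refine ⟨min ‖fresnel 0‖ c, lt_min h0 hcpos, fun w hw => ?_⟩
  rcases hw.eq_or_lt with rfl | hw
  · simp
  · refine (div_le_div_of_nonneg_right (min_le_right _ _) (by positivity)).trans ?_
    have hre := antidiagDir_mul_re w
    have hpos : 0 < ((w : ℂ) * antidiagDir).re := by rw [hre]; positivity
    -- The cut-off must shrink with `w`: a fixed `m` would give a bound that tends to `0` with `w`.
    have hm := halfGauss_re_ge hpos (m := min w 1) (le_min hw.le zero_le_one) (min_le_right _ _)
    rw [norm_fresnel_eq]
    refine le_trans ?_ (hm.trans (Complex.re_le_norm _))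
    rw [hre, norm_mul, norm_antidiagDir, mul_one, Complex.norm_real, Real.norm_of_nonneg hw.le]
    have key : 1 / (4 * (1 + w)) ≤ min w 1 * w / (w + min w 1) ^ 2 := by
      rcases le_total w 1 with h | h
      · rw [min_eq_left h, div_le_div_iff₀ (by positivity) (by positivity)]
        nlinarith [pow_pos hw 3, pow_pos hw 2]
      · rw [min_eq_right h, div_le_div_iff₀ (by positivity) (by positivity)]
        nlinarith
    have heq : 1 / (2 * Real.sqrt Real.pi) * (min w 1 * (Real.exp (-1) *
        (w * (Real.sqrt 2 / 2) / (w + min w 1) ^ 2))) =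
        (1 / (2 * Real.sqrt Real.pi) * (Real.exp (-1) * (Real.sqrt 2 / 2))) *
          (min w 1 * w / (w + min w 1) ^ 2) := by ring
    have heq2 : c / (1 + w) = (1 / (2 * Real.sqrt Real.pi) * (Real.exp (-1) * (Real.sqrt 2 / 2))) *
        (1 / (4 * (1 + w))) := by
      rw [hc]; field_simp
    rw [heq, heq2]
    exact mul_le_mul_of_nonneg_left key (by positivity)

/-! ### The quadratic model. -/

/-- The quadratic model of the reduced integral, along any ray of direction in `(0, π/4]`. -/
theorem rayIntegral_quadratic {N w φ : ℝ} (hN : 0 < N) (hw : 0 ≤ w) (hφ0 : 0 < φ)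
    (hφ : φ ≤ Real.pi / 4) :
    RayIntegrable (fun ζ => Complex.exp (Complex.I * (N * ζ ^ 2 + 2 * Real.sqrt N * w * ζ))) 0 φ ∧
    rayIntegral (fun ζ => Complex.exp (Complex.I * (N * ζ ^ 2 + 2 * Real.sqrt N * w * ζ))) 0 φ =
      ((1 / Real.sqrt N : ℝ) : ℂ) * (Complex.exp (-Complex.I * (w : ℂ) ^ 2) * fresnel w) := by
  have hpi := Real.pi_pos
  set f : ℂ → ℂ := fun ζ => Complex.exp (Complex.I * (N * ζ ^ 2 + 2 * Real.sqrt N * w * ζ)) with hf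
  have hdiff : Differentiable ℂ f := by rw [hf]; fun_prop
  have hsq : 0 < Real.sqrt N := Real.sqrt_pos.2 hN
  -- This is `N sin 2φ`. As `sin 2θ` increases up to `π/4`, it is a decay rate for the whole sector
  -- swept in rotating to the diagonal.
  set m : ℝ := N * (2 * Real.sin φ * Real.cos φ) with hm
  have hmpos : 0 < m := by
    have h1 := Real.sin_pos_of_pos_of_lt_pi hφ0 (by linarith)
    have h2 := Real.cos_pos_of_mem_Ioo (x := φ) ⟨by linarith, by linarith⟩
    positivity
  have hK : ∀ r : ℝ, 1 ≤ r → ∀ θ ∈ Icc φ (Real.pi / 4),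
      ‖f (rayPoint 0 θ r)‖ ≤ 1 * Real.exp (-m * r) := by
    intro r hr θ hθ
    rw [hf, one_mul]
    simp only
    rw [Complex.norm_exp]
    have hre : (Complex.I * (N * rayPoint 0 θ r ^ 2 + 2 * Real.sqrt N * w * rayPoint 0 θ r)).re =
        -(N * (2 * (rayPoint 0 θ r).re * (rayPoint 0 θ r).im) +
          2 * Real.sqrt N * w * (rayPoint 0 θ r).im) := by
      rw [Complex.I_mul_re]
      simp only [sq, Complex.add_im, Complex.mul_im, Complex.mul_re, Complex.ofReal_re,
        Complex.ofReal_im, Complex.re_ofNat, Complex.im_ofNat]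
      ring
    rw [hre, rayPoint_re, rayPoint_im]
    have hsin : 0 ≤ Real.sin θ :=
      Real.sin_nonneg_of_nonneg_of_le_pi (by linarith [hθ.1]) (by linarith [hθ.2])
    have h2 : 2 * Real.sin φ * Real.cos φ ≤ 2 * Real.sin θ * Real.cos θ := by
      rw [← Real.sin_two_mul, ← Real.sin_two_mul]
      exact Real.sin_le_sin_of_le_of_le_pi_div_two (by linarith) (by linarith [hθ.2])
        (by linarith [hθ.1])
    have h3 : m * r ≤ N * (2 * Real.sin θ * Real.cos θ) * r ^ 2 := by
      have : m ≤ N * (2 * Real.sin θ * Real.cos θ) := mul_le_mul_of_nonneg_left h2 hN.le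
      have h5 : r ≤ r ^ 2 := by nlinarith
      exact (mul_le_mul_of_nonneg_right this (by linarith)).trans
        (mul_le_mul_of_nonneg_left h5 (hmpos.le.trans this))
    have h4 : 0 ≤ 2 * Real.sqrt N * w * (r * Real.sin θ) := by positivity
    gcongr
    nlinarith
  constructor
  · exact rayIntegrable_of_exp_decay hmpos (fun r _ => hdiff.continuous.continuousAt)
      fun r hr => hK r hr φ ⟨le_rfl, hφ⟩
  · rw [rayIntegral_eq_of_exp_decay hφ hmpos (fun r _ θ _ => hdiff _) hdiff.continuous.continuousAt
      hK, exp_mul_fresnel, rayIntegral, halfGauss, integral_mul_const]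
    have hfun : ∀ r : ℝ, f (rayPoint 0 (Real.pi / 4) r) = Complex.exp
        (-((Real.sqrt N * r : ℝ) : ℂ) ^ 2 - 2 * (w * antidiagDir) * ((Real.sqrt N * r : ℝ) : ℂ)) := by
      intro r
      rw [hf]
      simp only
      rw [rayPoint_zero_eq]
      congr 1
      change Complex.I * (N * (r * diagDir) ^ 2 + 2 * Real.sqrt N * w * (r * diagDir)) = _
      have hNs : ((Real.sqrt N : ℝ) : ℂ) ^ 2 = N := by
        exact_mod_cast Real.sq_sqrt hN.le
      push_cast
      linear_combination (N * (r : ℂ) ^ 2) * Complex.I_mul_I +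
        (Complex.I * N * (r : ℂ) ^ 2) * diagDir_sq +
        (2 * Real.sqrt N * w * r : ℂ) * I_mul_diagDir + (r : ℂ) ^ 2 * hNs
    simp only [hfun]
    rw [integral_comp_mul_left_Ioi (fun s : ℝ =>
      Complex.exp (-(s : ℂ) ^ 2 - 2 * (w * antidiagDir) * s)) 0 hsq, mul_zero, Complex.real_smul,
      one_div]
    change _ * diagDir = _
    ring

/-! ### The parameters and the admissible angles. -/

theorem rpow_sub_one_mem {δ t : ℝ} (hδ : δ < 1) (ht : 1 < t) :
    0 < t ^ (δ - 1) ∧ t ^ (δ - 1) < 1 :=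
  ⟨Real.rpow_pos_of_pos (by linarith) _, Real.rpow_lt_one_of_one_lt_of_neg ht (by linarith)⟩

theorem lamC_pos {δ t : ℝ} (hδ : δ < 1) (ht : 1 < t) : 0 < lamC δ t := by
  obtain ⟨h0, h1⟩ := rpow_sub_one_mem hδ ht
  exact div_pos h0 (by linarith)

theorem one_add_lamC {δ t : ℝ} (hδ : δ < 1) (ht : 1 < t) :
    1 + lamC δ t = 1 / (1 - t ^ (δ - 1)) := by
  have : 1 - t ^ (δ - 1) ≠ 0 := by linarith [(rpow_sub_one_mem hδ ht).2]
  rw [lamC]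
  field_simp
  ring

theorem rpow_sub_one_eq_inv_lamC {δ t : ℝ} (hδ : δ < 1) (ht : 1 < t) :
    t ^ (1 - δ) - 1 = 1 / lamC δ t := by
  obtain ⟨h0, h1⟩ := rpow_sub_one_mem hδ ht
  have h2 : t ^ (1 - δ) = (t ^ (δ - 1))⁻¹ := by
    rw [← Real.rpow_neg (by linarith)]
    congr 1; ring
  rw [h2, lamC, one_div_div]
  field_simp

theorem Lam_nonneg {δ t Lam : ℝ} (hδ : δ < 1) (ht : 1 < t)
    (h : lamC δ t * (1 + Lam) ∈ lamRange δ t) : 0 ≤ Lam := by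
  have hpos := lamC_pos hδ ht
  have h1 := h.1
  by_contra hneg
  push Not at hneg
  nlinarith

/-- The upper end of the range is `1/λ_c`, so a nonempty range forces `λ_c² ≤ 1`. -/
theorem lamC_le_one {δ t Lam : ℝ} (hδ : δ < 1) (ht : 1 < t)
    (h : lamC δ t * (1 + Lam) ∈ lamRange δ t) : lamC δ t ≤ 1 := by
  have hpos := lamC_pos hδ ht
  have h1 : lamC δ t ≤ 1 / lamC δ t := by
    rw [← rpow_sub_one_eq_inv_lamC hδ ht]
    exact h.1.trans h.2
  rw [le_div_iff₀ hpos] at h1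
  nlinarith

theorem log_lam {δ t Lam : ℝ} (hδ : δ < 1) (ht : 1 < t) (hL : 0 ≤ Lam) :
    Real.log (lamC δ t * (1 + Lam)) = Real.log (lamC δ t) + Real.log (1 + Lam) :=
  Real.log_mul (lamC_pos hδ ht).ne' (by linarith)

theorem AdmissibleAngle.mem_Ioo {lam φ : ℝ} (h : AdmissibleAngle lam φ) :
    0 < φ ∧ φ < Real.pi / 2 := by
  rcases h with ⟨_, h1, h2⟩ | ⟨_, h1, h2⟩
  · exact ⟨h1, h2⟩
  · exact ⟨h1, h2.trans (Real.arctan_lt_pi_div_two _)⟩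

/-- The quantity is `Im((ln λ + iπ) e^{iφ})`, which governs the growth of the imaginary part of the
phase at infinity; this is where the bound `tan φ < π/|ln λ|` comes from. -/
theorem AdmissibleAngle.pos {lam φ : ℝ} (h : AdmissibleAngle lam φ) :
    0 < Real.log lam * Real.sin φ + Real.pi * Real.cos φ := by
  obtain ⟨h0, h1⟩ := h.mem_Ioo
  have hpi := Real.pi_pos
  have hs : 0 < Real.sin φ := Real.sin_pos_of_pos_of_lt_pi h0 (by linarith)
  have hc : 0 < Real.cos φ := Real.cos_pos_of_mem_Ioo ⟨by linarith, h1⟩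
  rcases h with ⟨hl, _, _⟩ | ⟨hl, _, h2⟩
  · positivity
  · have h3 : Real.tan φ < Real.pi / |Real.log lam| := by
      have := Real.tan_lt_tan_of_lt_of_lt_pi_div_two (by linarith) (Real.arctan_lt_pi_div_two _) h2
      rwa [Real.tan_arctan] at this
    rw [abs_of_neg hl, Real.tan_eq_sin_div_cos, div_lt_div_iff₀ hc (by linarith)] at h3
    linarith

theorem AdmissibleAngle.of_mem_Icc {lam φ₁ φ₂ θ : ℝ} (h1 : AdmissibleAngle lam φ₁)
    (h2 : AdmissibleAngle lam φ₂) (h : θ ∈ Icc φ₁ φ₂) : AdmissibleAngle lam θ := by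
  have h0 := h1.mem_Ioo.1
  rcases h2 with ⟨hl, _, h3⟩ | ⟨hl, _, h3⟩
  · exact Or.inl ⟨hl, h0.trans_le h.1, h.2.trans_lt h3⟩
  · exact Or.inr ⟨hl, h0.trans_le h.1, h.2.trans_lt h3⟩

/-! ### Exponential decay at infinity, convergence and independence of the angle. -/

/-- For `Im ζ > 0` the point `1 - ζ` lies in the lower half plane, which produces the `iπ`. The
remaining two arguments both lie in `(0, π)`, so their difference stays on the principal branch. -/
theorem log_sub_log_one_sub_of_im_pos {a : ℝ} (ha : 0 < a) {ζ : ℂ} (hζ : 0 < ζ.im) :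
    Complex.log (1 + a * ζ) - Complex.log (1 - ζ) =
      Real.pi * Complex.I + Complex.log ((1 + a * ζ) / (ζ - 1)) := by
  have hx : 0 < (1 + a * ζ).im := by simpa using mul_pos ha hζ
  have hy : 0 < (ζ - 1).im := by simpa using hζ
  have hx0 : 1 + a * ζ ≠ 0 := fun h => by rw [h] at hx; simp at hx
  have hy0 : ζ - 1 ≠ 0 := fun h => by rw [h] at hy; simp at hy
  have harg : ∀ z : ℂ, 0 < z.im → z.arg ∈ Ioo 0 Real.pi := fun z hz => by
    refine ⟨lt_of_le_of_ne (Complex.arg_nonneg_iff.2 hz.le) fun h => ?_, Complex.arg_lt_pi_iff.2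
      (Or.inr hz.ne')⟩
    exact hz.ne' (Complex.arg_eq_zero_iff.1 h.symm).2
  have h1 := harg _ hx
  have h2 := harg _ hy
  have hneg : Complex.log (1 - ζ) = Complex.log (ζ - 1) - Real.pi * Complex.I := by
    apply Complex.ext
    · simp [Complex.log_re, norm_sub_rev]
    · rw [← neg_sub ζ 1, Complex.log_im, Complex.arg_neg_eq_arg_sub_pi_of_im_pos hy]
      simp [Complex.log_im]
  have hdiv : Complex.log ((1 + a * ζ) / (ζ - 1)) =
      Complex.log (1 + a * ζ) - Complex.log (ζ - 1) := by
    rw [← Complex.log_exp (x := Complex.log (1 + a * ζ) - Complex.log (ζ - 1)), Complex.exp_sub,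
      Complex.exp_log hx0, Complex.exp_log hy0]
    · rw [Complex.sub_im, Complex.log_im, Complex.log_im]; linarith [h1.1, h2.2]
    · rw [Complex.sub_im, Complex.log_im, Complex.log_im]; linarith [h1.2, h2.1]
  rw [hneg, hdiv]; ring

theorem tendsto_log_ratio {a : ℝ} (ha : 0 < a) :
    Tendsto (fun ζ : ℂ => Complex.log ((1 + a * ζ) / (ζ - 1))) (Bornology.cobounded ℂ)
      (𝓝 (Real.log a : ℂ)) := by
  have hinv : Tendsto (fun ζ : ℂ => ζ⁻¹) (Bornology.cobounded ℂ) (𝓝 0) :=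
    tendsto_inv₀_cobounded
  have h1 : Tendsto (fun ζ : ℂ => (ζ⁻¹ + a) / (1 - ζ⁻¹)) (Bornology.cobounded ℂ) (𝓝 (a : ℂ)) := by
    have := (hinv.add_const (a : ℂ)).div (tendsto_const_nhds.sub hinv) (b := (1 - 0 : ℂ)) (by simp)
    simpa [Pi.div_def] using this
  have h2 : Tendsto (fun ζ : ℂ => (1 + a * ζ) / (ζ - 1)) (Bornology.cobounded ℂ) (𝓝 (a : ℂ)) := by
    refine h1.congr' ?_
    filter_upwards [Bornology.eventually_ne_cobounded (0 : ℂ)] with ζ hζ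
    rw [← mul_div_mul_left _ _ hζ]
    congr 1
    · field_simp
    · field_simp
  rw [Complex.ofReal_log ha.le]
  exact (continuousAt_clog (Complex.ofReal_mem_slitPlane.2 ha)).tendsto.comp h2

/-- At infinity `f₁ ~ λ_c ζ (ln λ + iπ)`, and compactness of the angle interval gives a uniform
positive slope `m`. Half of `m` absorbs the error in the logarithm and a quarter absorbs the bounded
arguments of the free logarithms. -/
theorem exists_mul_le_im_f1 {lc Lam φ₁ φ₂ : ℝ} (hlc : 0 < lc) (hφ0 : 0 < φ₁) (h12 : φ₁ ≤ φ₂)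
    (hφ : φ₂ < Real.pi / 2)
    (hpos : ∀ θ ∈ Icc φ₁ φ₂,
      0 < (Real.log lc + Real.log (1 + Lam)) * Real.sin θ + Real.pi * Real.cos θ) :
    ∃ c R : ℝ, 0 < c ∧ 0 < R ∧ ∀ r : ℝ, R ≤ r → ∀ θ ∈ Icc φ₁ φ₂,
      c * r ≤ (f1 lc Lam (rayPoint 0 θ r)).im := by
  have hpi := Real.pi_pos
  obtain ⟨θ₀, hθ₀, hmin⟩ := isCompact_Icc.exists_isMinOn (nonempty_Icc.2 h12)
    (f := fun θ => (Real.log lc + Real.log (1 + Lam)) * Real.sin θ + Real.pi * Real.cos θ)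
    (by fun_prop)
  set m := (Real.log lc + Real.log (1 + Lam)) * Real.sin θ₀ + Real.pi * Real.cos θ₀ with hm
  have hm0 : 0 < m := hpos θ₀ hθ₀
  have hev := (tendsto_log_ratio hlc).eventually (Metric.closedBall_mem_nhds _ (half_pos hm0))
  obtain ⟨R₀, -, hR₀⟩ := (hasBasis_cobounded_norm (E := ℂ)).eventually_iff.1 hev
  refine ⟨lc * (m / 4), max (max R₀ 1) (Real.pi * (1 + lc) / (lc * (m / 4))), by positivity,
    by positivity, ?_⟩
  intro r hr θ hθ
  have hr1 : R₀ ≤ r := (le_max_left _ _).trans ((le_max_left _ _).trans hr)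
  have hr2 : 0 < r := zero_lt_one.trans_le ((le_max_right R₀ 1).trans ((le_max_left _ _).trans hr))
  have hr3 : Real.pi * (1 + lc) ≤ lc * (m / 4) * r := by
    have := (le_max_right _ _).trans hr
    rw [div_le_iff₀ (by positivity)] at this
    linarith
  set ζ := rayPoint 0 θ r with hζ
  have hsin : 0 < Real.sin θ := Real.sin_pos_of_pos_of_lt_pi (by linarith [hθ.1])
    (by linarith [hθ.2])
  have hn : ‖ζ‖ = r := norm_rayPoint_zero θ hr2.le
  have hre : ζ.re = r * Real.cos θ := rayPoint_re θ r
  have him : ζ.im = r * Real.sin θ := rayPoint_im θ r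
  have himp : 0 < ζ.im := by rw [him]; positivity
  have hclose := hR₀ (show R₀ ≤ ‖ζ‖ by rw [hn]; exact hr1)
  have hE := log_sub_log_one_sub_of_im_pos hlc himp
  set e : ℂ := Complex.log ((1 + lc * ζ) / (ζ - 1)) - Real.log lc with he
  have hen : ‖e‖ ≤ m / 2 := by
    simpa [dist_eq_norm, he] using hclose
  have hf : f1 lc Lam ζ = ((lc : ℝ) : ℂ) * (ζ * ((Real.log lc + Real.log (1 + Lam) : ℝ) +
      (Real.pi : ℝ) * Complex.I) + ζ * e) + Complex.log (1 + lc * ζ) +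
      (lc : ℂ) * Complex.log (1 - ζ) := by
    rw [f1, add_sub_assoc, hE, he]
    push_cast
    ring
  have h1 : (ζ * ((Real.log lc + Real.log (1 + Lam) : ℝ) + (Real.pi : ℝ) * Complex.I)).im =
      r * ((Real.log lc + Real.log (1 + Lam)) * Real.sin θ + Real.pi * Real.cos θ) := by
    rw [Complex.mul_im, hre, him]
    simp
    ring
  have h2 : -(r * (m / 2)) ≤ (ζ * e).im := by
    have := (abs_le.1 (Complex.abs_im_le_norm (ζ * e))).1
    rw [norm_mul, hn] at this
    have h3 := mul_le_mul_of_nonneg_left hen hr2.le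
    linarith
  have h4 : m ≤ (Real.log lc + Real.log (1 + Lam)) * Real.sin θ + Real.pi * Real.cos θ :=
    isMinOn_iff.1 hmin θ hθ
  rw [hf, Complex.add_im, Complex.add_im, Complex.im_ofReal_mul, Complex.im_ofReal_mul,
    Complex.add_im, h1, Complex.log_im, Complex.log_im]
  have h5 := Complex.neg_pi_lt_arg (1 + lc * ζ)
  have h6 := mul_le_mul_of_nonneg_left (Complex.neg_pi_lt_arg (1 - ζ)).le hlc.le
  have h7 := mul_le_mul_of_nonneg_left (mul_le_mul_of_nonneg_left h4 hr2.le) hlc.le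
  have h8 := mul_le_mul_of_nonneg_left h2 hlc.le
  nlinarith

/-- The line of direction `θ` through `0` has distance `|sin θ|` from `1`. -/
theorem sin_le_norm_one_sub_rayPoint {θ : ℝ} (r : ℝ) :
    Real.sin θ ≤ ‖1 - rayPoint 0 θ r‖ := by
  refine Real.le_sqrt_of_sq_le ?_
  rw [Complex.normSq_apply]
  simp only [Complex.sub_re, Complex.sub_im, Complex.one_re, Complex.one_im, rayPoint_re,
    rayPoint_im]
  nlinarith [Real.sin_sq_add_cos_sq θ, sq_nonneg (r - Real.cos θ)]

theorem norm_ampG_le {δ σ t θ r : ℝ} (hσ0 : 1 / 2 ≤ σ) (hσ1 : σ < 1) (hlc0 : 0 < lamC δ t)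
    (hlc : lamC δ t ≤ 1) (hs : 0 < Real.sin θ) (hr : 0 ≤ r) :
    ‖ampG δ σ t (rayPoint 0 θ r)‖ ≤ 1 / Real.sin θ * (1 + r) := by
  have e1 : (-(1 / 2) : ℂ) = ((-(1 / 2) : ℝ) : ℂ) := by push_cast; rfl
  have e2 : ((σ : ℂ) - 1 / 2) = ((σ - 1 / 2 : ℝ) : ℂ) := by push_cast; rfl
  rw [ampG, norm_mul, e1, e2, Complex.norm_cpow_real, Complex.norm_cpow_real]
  have hs1 := Real.sin_le_one θ
  have h1 : ‖1 - rayPoint 0 θ r‖ ^ (-(1 / 2) : ℝ) ≤ 1 / Real.sin θ := by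
    refine (Real.rpow_le_rpow_of_nonpos hs (sin_le_norm_one_sub_rayPoint r)
      (by norm_num)).trans ?_
    refine (Real.rpow_le_rpow_of_exponent_ge hs hs1 (show (-1 : ℝ) ≤ -(1 / 2) by norm_num)).trans ?_
    rw [Real.rpow_neg_one, one_div]
  have h2 : ‖1 + (lamC δ t : ℂ) * rayPoint 0 θ r‖ ≤ 1 + r := by
    refine (norm_add_le _ _).trans ?_
    rw [norm_one, norm_mul, norm_rayPoint_zero θ hr, Complex.norm_real,
      Real.norm_of_nonneg hlc0.le]
    nlinarith
  have h3 : ‖1 + (lamC δ t : ℂ) * rayPoint 0 θ r‖ ^ (σ - 1 / 2) ≤ 1 + r := by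
    refine (Real.rpow_le_rpow (norm_nonneg _) h2 (by linarith)).trans ?_
    refine (Real.rpow_le_rpow_of_exponent_le (by linarith) (show σ - 1 / 2 ≤ 1 by linarith)).trans ?_
    rw [Real.rpow_one]
  exact mul_le_mul h1 h3 (by positivity) (by positivity)

theorem one_sub_rayPoint_mem_slitPlane {θ r : ℝ} (hs : 0 < Real.sin θ) (hr : 0 ≤ r) :
    1 - rayPoint 0 θ r ∈ Complex.slitPlane := by
  rcases hr.eq_or_lt with rfl | hr
  · simp [rayPoint]
  · right
    rw [Complex.sub_im, rayPoint_im]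
    simp only [Complex.one_im, zero_sub, neg_ne_zero]
    positivity

theorem one_add_mul_rayPoint_mem_slitPlane {a θ r : ℝ} (ha : 0 ≤ a) (hc : 0 ≤ Real.cos θ)
    (hr : 0 ≤ r) : 1 + (a : ℂ) * rayPoint 0 θ r ∈ Complex.slitPlane := by
  left
  rw [Complex.add_re, Complex.re_ofReal_mul, rayPoint_re, Complex.one_re]
  positivity

theorem differentiableAt_integrandTilde {δ σ t Lam : ℝ} {ζ : ℂ}
    (h1 : 1 - ζ ∈ Complex.slitPlane) (h2 : 1 + (lamC δ t : ℂ) * ζ ∈ Complex.slitPlane) :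
    DifferentiableAt ℂ (integrandTilde δ σ t Lam) ζ := by
  have d1 : DifferentiableAt ℂ (fun z : ℂ => 1 - z) ζ := by fun_prop
  have d2 : DifferentiableAt ℂ (fun z : ℂ => 1 + (lamC δ t : ℂ) * z) ζ := by fun_prop
  have l1 := d1.clog h1
  have l2 := d2.clog h2
  have p1 := d1.cpow (differentiableAt_const (-(1 / 2) : ℂ)) h1
  have p2 := d2.cpow (differentiableAt_const ((σ : ℂ) - 1 / 2)) h2
  unfold integrandTilde ampG phaseH f1
  refine (p1.mul p2).mul ?_
  fun_prop

theorem norm_exp_phaseH {δ t Lam : ℝ} (ζ : ℂ) :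
    ‖Complex.exp (Complex.I * (t : ℂ) * phaseH δ t Lam ζ)‖ =
      Real.exp (-(t / (1 + lamC δ t) * (f1 (lamC δ t) Lam ζ).im)) := by
  rw [Complex.norm_exp, phaseH]
  congr 1
  have : Complex.I * (t : ℂ) * (f1 (lamC δ t) Lam ζ / (1 + (lamC δ t : ℂ))) =
      ((t / (1 + lamC δ t) : ℝ) : ℂ) * (Complex.I * f1 (lamC δ t) Lam ζ) := by
    push_cast; ring
  rw [this, Complex.re_ofReal_mul, Complex.I_mul_re, mul_neg]

theorem exists_norm_integrandTilde_le {δ σ t Lam φ₁ φ₂ : ℝ} (hδ : δ < 1) (hσ0 : 1 / 2 ≤ σ)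
    (hσ1 : σ < 1) (ht : 1 < t) (hlam : lamC δ t * (1 + Lam) ∈ lamRange δ t) (h12 : φ₁ ≤ φ₂)
    (h1 : AdmissibleAngle (lamC δ t * (1 + Lam)) φ₁)
    (h2 : AdmissibleAngle (lamC δ t * (1 + Lam)) φ₂) :
    ∃ K c R : ℝ, 0 < c ∧ ∀ r : ℝ, R ≤ r → ∀ θ ∈ Icc φ₁ φ₂,
      ‖integrandTilde δ σ t Lam (rayPoint 0 θ r)‖ ≤ K * Real.exp (-c * r) := by
  have hlc := lamC_pos hδ ht
  have hlc1 := lamC_le_one hδ ht hlam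
  have hL := Lam_nonneg hδ ht hlam
  obtain ⟨c, R, hc, hR, hcR⟩ := exists_mul_le_im_f1 (Lam := Lam) hlc h1.mem_Ioo.1 h12 h2.mem_Ioo.2
    (fun θ hθ => by
      have := (h1.of_mem_Icc h2 hθ).pos
      rwa [log_lam hδ ht hL] at this)
  -- Half of the available decay rate; the other half absorbs the linear growth of the amplitude.
  set κ := t / (1 + lamC δ t) * c / 2 with hκ
  have hκ0 : 0 < κ := by positivity
  have hs1 : 0 < Real.sin φ₁ :=
    Real.sin_pos_of_pos_of_lt_pi h1.mem_Ioo.1 (by linarith [h1.mem_Ioo.2, Real.pi_pos])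
  refine ⟨1 / Real.sin φ₁ * (1 + 1 / κ), κ, R, hκ0, fun r hr θ hθ => ?_⟩
  have hr0 : 0 < r := hR.trans_le hr
  have hsle : Real.sin φ₁ ≤ Real.sin θ :=
    Real.sin_le_sin_of_le_of_le_pi_div_two (by linarith [h1.mem_Ioo.1, Real.pi_pos])
      (by linarith [h2.mem_Ioo.2, hθ.2]) hθ.1
  have hs := hs1.trans_le hsle
  rw [integrandTilde, norm_mul, norm_exp_phaseH]
  have ha := norm_ampG_le (δ := δ) (t := t) hσ0 hσ1 hlc hlc1 hs hr0.le
  have hb : 1 + r ≤ (1 + 1 / κ) * Real.exp (κ * r) := by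
    have h3 := Real.add_one_le_exp (κ * r)
    have h4 : 1 ≤ Real.exp (κ * r) := Real.one_le_exp (by positivity)
    have h5 : 1 / κ * (κ * r) = r := by field_simp
    have h6 := mul_le_mul_of_nonneg_left h3 (show 0 ≤ 1 / κ by positivity)
    have h7 : 0 < 1 / κ := by positivity
    nlinarith
  have hd : Real.exp (-(t / (1 + lamC δ t) * (f1 (lamC δ t) Lam (rayPoint 0 θ r)).im)) ≤
      Real.exp (-(κ * r) + -(κ * r)) := by
    gcongr
    have h8 := mul_le_mul_of_nonneg_left (hcR r hr θ hθ)
      (show 0 ≤ t / (1 + lamC δ t) by positivity)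
    have h9 : t / (1 + lamC δ t) * (c * r) = 2 * (κ * r) := by rw [hκ]; ring
    linarith
  calc ‖ampG δ σ t (rayPoint 0 θ r)‖ *
        Real.exp (-(t / (1 + lamC δ t) * (f1 (lamC δ t) Lam (rayPoint 0 θ r)).im))
      ≤ (1 / Real.sin φ₁ * ((1 + 1 / κ) * Real.exp (κ * r))) *
        Real.exp (-(κ * r) + -(κ * r)) := by
        refine mul_le_mul (ha.trans ?_) hd (Real.exp_nonneg _) (by positivity)
        gcongr
    _ = 1 / Real.sin φ₁ * (1 + 1 / κ) * Real.exp (-κ * r) := by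
        rw [Real.exp_add, Real.exp_neg, neg_mul, Real.exp_neg]
        field_simp

theorem differentiableAt_integrandTilde_rayPoint {δ σ t Lam φ r : ℝ} (hδ : δ < 1) (ht : 1 < t)
    (hφ0 : 0 < φ) (hφ : φ < Real.pi / 2) (hr : 0 ≤ r) :
    DifferentiableAt ℂ (integrandTilde δ σ t Lam) (rayPoint 0 φ r) := by
  have hpi := Real.pi_pos
  exact differentiableAt_integrandTilde
    (one_sub_rayPoint_mem_slitPlane (Real.sin_pos_of_pos_of_lt_pi hφ0 (by linarith)) hr)
    (one_add_mul_rayPoint_mem_slitPlane (lamC_pos hδ ht).le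
      (Real.cos_pos_of_mem_Ioo ⟨by linarith, hφ⟩).le hr)

theorem rayIntegrable_integrandTilde {δ σ t Lam φ : ℝ} (hδ : δ < 1) (hσ0 : 1 / 2 ≤ σ)
    (hσ1 : σ < 1) (ht : 1 < t) (hlam : lamC δ t * (1 + Lam) ∈ lamRange δ t)
    (hφ : AdmissibleAngle (lamC δ t * (1 + Lam)) φ) :
    RayIntegrable (integrandTilde δ σ t Lam) 0 φ := by
  obtain ⟨K, c, R, hc, hK⟩ := exists_norm_integrandTilde_le hδ hσ0 hσ1 ht hlam le_rfl hφ hφ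
  exact rayIntegrable_of_exp_decay hc (fun r hr => (differentiableAt_integrandTilde_rayPoint hδ ht
    hφ.mem_Ioo.1 hφ.mem_Ioo.2 hr).continuousAt) fun r hr => hK r hr φ ⟨le_rfl, le_rfl⟩

/-- The reduced integral does not depend on the admissible direction of integration. -/
theorem JBtilde_eq_of_admissible {δ σ t Lam φ₁ φ₂ : ℝ} (hδ : δ < 1) (hσ0 : 1 / 2 ≤ σ)
    (hσ1 : σ < 1) (ht : 1 < t) (hlam : lamC δ t * (1 + Lam) ∈ lamRange δ t)
    (h1 : AdmissibleAngle (lamC δ t * (1 + Lam)) φ₁)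
    (h2 : AdmissibleAngle (lamC δ t * (1 + Lam)) φ₂) :
    JBtilde δ σ t Lam φ₁ = JBtilde δ σ t Lam φ₂ := by
  wlog h12 : φ₁ ≤ φ₂ generalizing φ₁ φ₂
  · exact (this h2 h1 (le_of_not_ge h12)).symm
  obtain ⟨K, c, R, hc, hK⟩ := exists_norm_integrandTilde_le hδ hσ0 hσ1 ht hlam h12 h1 h2
  refine rayIntegral_eq_of_exp_decay h12 hc (fun r hr θ hθ => ?_) ?_ hK
  · have := (h1.of_mem_Icc h2 hθ).mem_Ioo
    exact differentiableAt_integrandTilde_rayPoint hδ ht this.1 this.2 hr.le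
  · refine (differentiableAt_integrandTilde ?_ ?_).continuousAt <;> simp

/-! ### The substitution relating the two integrals. -/

/-- With `s = t^{δ-1}` and `z = (1-s)(1+λ_c ζ)` one has `1 - z = s(1-ζ)`, because `(1-s)λ_c = s`.
Positive factors split off principal logarithms without branch corrections. The factor `s` on the
left is `dz/dζ`. -/
theorem integrandJB_rayPoint {δ σ t Lam φ r : ℝ} (hδ : δ < 1) (ht : 1 < t)
    (hlam : lamC δ t * (1 + Lam) ∈ lamRange δ t) (hφ0 : 0 < φ) (hφ : φ < Real.pi / 2)
    (hr : 0 ≤ r) :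
    (t ^ (δ - 1) : ℝ) * integrandJB σ t (lamC δ t * (1 + Lam))
        (rayPoint ((1 - t ^ (δ - 1) : ℝ) : ℂ) φ (t ^ (δ - 1) * r)) =
      prefactor δ σ t Lam * integrandTilde δ σ t Lam (rayPoint 0 φ r) := by
  have hpi := Real.pi_pos
  have hL := Lam_nonneg hδ ht hlam
  have hlc := lamC_pos hδ ht
  have h1lc := one_add_lamC hδ ht
  obtain ⟨hs0, hs1⟩ := rpow_sub_one_mem hδ ht
  set ζ := rayPoint 0 φ r with hζ
  have hA : 1 - ζ ≠ 0 := Complex.slitPlane_ne_zero (one_sub_rayPoint_mem_slitPlane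
    (Real.sin_pos_of_pos_of_lt_pi hφ0 (by linarith)) hr)
  have hB : 1 + (lamC δ t : ℂ) * ζ ≠ 0 := Complex.slitPlane_ne_zero
    (one_add_mul_rayPoint_mem_slitPlane hlc.le (Real.cos_pos_of_mem_Ioo ⟨by linarith, hφ⟩).le hr)
  have hll := log_lam hδ ht hL
  have hf0 : f0 Lam (lamC δ t) = Real.log (t ^ (δ - 1)) + Real.log (1 + Lam) +
      lamC δ t * Real.log (t ^ (δ - 1)) := by
    have e1 : lamC δ t * (1 + Lam) / (1 + lamC δ t) = t ^ (δ - 1) * (1 + Lam) := by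
      rw [h1lc, lamC]
      have : 1 - t ^ (δ - 1) ≠ 0 := by linarith
      field_simp
    have e2 : (1 + lamC δ t) / lamC δ t = (t ^ (δ - 1))⁻¹ := by
      rw [h1lc, lamC]
      have : 1 - t ^ (δ - 1) ≠ 0 := by linarith
      field_simp
    rw [f0, e1, e2, Real.log_inv, Real.log_mul hs0.ne' (by linarith)]
    ring
  have hlogc : Real.log (lamC δ t) = Real.log (t ^ (δ - 1)) - Real.log (1 - t ^ (δ - 1)) := by
    rw [lamC, Real.log_div hs0.ne' (by linarith)]
  have hq1 : lamC δ t / (1 + lamC δ t) = t ^ (δ - 1) := by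
    rw [h1lc, lamC]
    have : 1 - t ^ (δ - 1) ≠ 0 := by linarith
    field_simp
  have hq2 : 1 / (1 + lamC δ t) = 1 - t ^ (δ - 1) := by rw [h1lc, one_div_one_div]
  set l := lamC δ t with hl
  set s := t ^ (δ - 1) with hs
  have hls : (1 - s) * l = s := by rw [hl, lamC, ← hs]; field_simp [show 1 - s ≠ 0 by linarith]
  have hlsC : (1 - (s : ℂ)) * l = s := by exact_mod_cast hls
  have hz1 : rayPoint ((1 - s : ℝ) : ℂ) φ (s * r) = ((1 - s : ℝ) : ℂ) * (1 + l * ζ) := by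
    rw [hζ, rayPoint_zero_eq, rayPoint]
    push_cast
    linear_combination (-(r : ℂ) * Complex.exp (Complex.I * φ)) * hlsC
  have hz2 : 1 - ((1 - s : ℝ) : ℂ) * (1 + l * ζ) = ((s : ℝ) : ℂ) * (1 - ζ) := by
    push_cast
    linear_combination (-ζ) * hlsC
  have hsC : (s : ℂ) ≠ 0 := by exact_mod_cast hs0.ne'
  have h1s : 0 < 1 - s := by linarith
  have h1sC : ((1 - s : ℝ) : ℂ) ≠ 0 := by exact_mod_cast h1s.ne'
  have hsexp : (s : ℂ) = Complex.exp (Real.log s) := by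
    rw [← Complex.ofReal_exp, Real.exp_log hs0]
  have hexp : ∀ x y : ℝ, 0 < x → ((x ^ y : ℝ) : ℂ) = Complex.exp (Real.log x * y) := by
    intro x y hx
    rw [Real.rpow_def_of_pos hx]; push_cast; rfl
  rw [hz1, integrandJB, phaseF, hz2, Complex.log_ofReal_mul hs0 hA, Complex.log_ofReal_mul h1s hB,
    Complex.cpow_def_of_ne_zero (mul_ne_zero hsC hA),
    Complex.cpow_def_of_ne_zero (mul_ne_zero h1sC hB),
    Complex.log_ofReal_mul hs0 hA, Complex.log_ofReal_mul h1s hB, hll, hlogc, prefactor,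
    integrandTilde, ampG, phaseH, f1, ← hl, hf0, hq1, hq2, Complex.cpow_def_of_ne_zero hA,
    Complex.cpow_def_of_ne_zero hB, Complex.ofReal_mul, hexp _ _ hs0, hexp _ _ h1s]
  -- With the Jacobian also written as an exponential, it remains to compare exponents, an algebraic
  -- identity in the logarithms modulo `(1-s)λ_c = s`.
  nth_rewrite 1 [hsexp]
  simp only [← Complex.exp_add]
  congr 1
  have hinv : ((1 : ℂ) + l)⁻¹ = 1 - s := by
    have := hq2
    rw [one_div] at this
    exact_mod_cast this
  simp only [div_eq_mul_inv, hinv]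
  push_cast
  linear_combination (-(Complex.I * t * (1 - ζ) * ((Real.log s : ℝ) + Complex.log (1 - ζ)))) * hlsC

theorem JB_rayPoint_integrand {δ σ t Lam φ : ℝ} (hδ : δ < 1) (ht : 1 < t)
    (hlam : lamC δ t * (1 + Lam) ∈ lamRange δ t)
    (hφ : AdmissibleAngle (lamC δ t * (1 + Lam)) φ) {r : ℝ} (hr : 0 ≤ r) :
    integrandJB σ t (lamC δ t * (1 + Lam))
        (rayPoint ((1 - t ^ (δ - 1) : ℝ) : ℂ) φ (t ^ (δ - 1) * r)) *
        Complex.exp (Complex.I * (φ : ℂ)) =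
      (((t ^ (δ - 1) : ℝ) : ℂ)⁻¹ * prefactor δ σ t Lam) *
        (integrandTilde δ σ t Lam (rayPoint 0 φ r) * Complex.exp (Complex.I * (φ : ℂ))) := by
  have hs : ((t ^ (δ - 1) : ℝ) : ℂ) ≠ 0 := by
    exact_mod_cast (rpow_sub_one_mem hδ ht).1.ne'
  have h := integrandJB_rayPoint (σ := σ) hδ ht hlam hφ.mem_Ioo.1 hφ.mem_Ioo.2 hr
  rw [← mul_right_inj' hs, ← mul_assoc, h]
  field_simp

theorem rayIntegrable_integrandJB {δ σ t Lam φ : ℝ} (hδ : δ < 1) (hσ0 : 1 / 2 ≤ σ)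
    (hσ1 : σ < 1) (ht : 1 < t) (hlam : lamC δ t * (1 + Lam) ∈ lamRange δ t)
    (hφ : AdmissibleAngle (lamC δ t * (1 + Lam)) φ) :
    RayIntegrable (integrandJB σ t (lamC δ t * (1 + Lam))) ((1 - t ^ (δ - 1) : ℝ) : ℂ) φ := by
  have h := integrableOn_Ioi_comp_mul_left_iff (fun r : ℝ =>
    integrandJB σ t (lamC δ t * (1 + Lam)) (rayPoint ((1 - t ^ (δ - 1) : ℝ) : ℂ) φ r) *
      Complex.exp (Complex.I * (φ : ℂ))) 0 (rpow_sub_one_mem hδ ht).1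
  rw [mul_zero] at h
  refine h.1 (IntegrableOn.congr_fun ((rayIntegrable_integrandTilde hδ hσ0 hσ1 ht hlam
    hφ).const_mul (((t ^ (δ - 1) : ℝ) : ℂ)⁻¹ * prefactor δ σ t Lam)) (fun r hr => ?_)
    measurableSet_Ioi)
  exact (JB_rayPoint_integrand hδ ht hlam hφ (le_of_lt hr)).symm

theorem JB_eq_prefactor_mul {δ σ t Lam φ : ℝ} (hδ : δ < 1) (ht : 1 < t)
    (hlam : lamC δ t * (1 + Lam) ∈ lamRange δ t)
    (hφ : AdmissibleAngle (lamC δ t * (1 + Lam)) φ) :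
    JB δ σ t (lamC δ t * (1 + Lam)) φ = prefactor δ σ t Lam * JBtilde δ σ t Lam φ := by
  have hs := (rpow_sub_one_mem hδ ht).1
  have hsC : ((t ^ (δ - 1) : ℝ) : ℂ) ≠ 0 := by exact_mod_cast hs.ne'
  have h := integral_comp_mul_left_Ioi (fun r : ℝ =>
    integrandJB σ t (lamC δ t * (1 + Lam)) (rayPoint ((1 - t ^ (δ - 1) : ℝ) : ℂ) φ r) *
      Complex.exp (Complex.I * (φ : ℂ))) 0 hs
  rw [mul_zero, setIntegral_congr_fun measurableSet_Ioi (fun r hr =>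
    JB_rayPoint_integrand (σ := σ) hδ ht hlam hφ (le_of_lt hr)), integral_const_mul,
    Complex.real_smul, Complex.ofReal_inv, mul_assoc] at h
  exact (mul_left_cancel₀ (inv_ne_zero hsC) h).symm

/-! ### Lower bounds for the imaginary part of the phase along a ray. -/

theorem norm_exp_sub_exp_le {a b : ℂ} {m : ℝ} (ha : a.re ≤ m) (hb : b.re ≤ m) :
    ‖Complex.exp a - Complex.exp b‖ ≤ Real.exp m * ‖a - b‖ :=
  Convex.norm_image_sub_le_of_norm_deriv_le (𝕜 := ℂ) (s := {z : ℂ | z.re ≤ m})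
    (fun z _ => Complex.differentiableAt_exp)
    (fun z hz => by
      rw [Complex.deriv_exp, Complex.norm_exp]
      exact Real.exp_le_exp.2 hz)
    (convex_halfSpace_re_le m) hb ha

/-- The rational terms cancel, leaving a derivative made of logarithms only; its moduli and
arguments can be estimated separately. -/
theorem hasDerivAt_f1 {lc Lam : ℝ} {ζ : ℂ} (h1 : 1 - ζ ∈ Complex.slitPlane)
    (h2 : 1 + (lc : ℂ) * ζ ∈ Complex.slitPlane) :
    HasDerivAt (f1 lc Lam)
      (lc * (Real.log (1 + Lam) + Complex.log (1 + lc * ζ) - Complex.log (1 - ζ))) ζ := by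
  have d1 : HasDerivAt (fun z : ℂ => 1 - z) (-1) ζ := (hasDerivAt_id ζ).const_sub 1
  have d2 : HasDerivAt (fun z : ℂ => 1 + (lc : ℂ) * z) lc ζ := by
    simpa using ((hasDerivAt_id ζ).const_mul (lc : ℂ)).const_add 1
  have d3 : HasDerivAt (fun z : ℂ => (lc : ℂ) * z) lc ζ := by
    simpa using (hasDerivAt_id ζ).const_mul (lc : ℂ)
  have l1 := d1.clog h1
  have l2 := d2.clog h2
  have n1 := Complex.slitPlane_ne_zero h1
  have n2 := Complex.slitPlane_ne_zero h2
  have h := ((d3.mul ((l2.const_add (Real.log (1 + Lam) : ℂ)).sub l1)).add l2).add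
    (l1.const_mul (lc : ℂ))
  refine h.congr_deriv ?_
  simp only [Pi.sub_apply]
  field_simp
  ring

theorem hasDerivAt_rayPoint (a : ℂ) (φ r : ℝ) :
    HasDerivAt (rayPoint a φ) (Complex.exp (Complex.I * (φ : ℂ))) r := by
  have := ((hasDerivAt_id r).ofReal_comp.mul_const (Complex.exp (Complex.I * (φ : ℂ)))).const_add a
  exact this.congr_deriv (by simp)

/-- The radial derivative of `Im f₁`, divided by `λ_c`. -/
noncomputable def radialSlope (lc Lam φ r : ℝ) : ℝ :=
  Real.sin φ * (Real.log (1 + Lam) + Real.log ‖1 + (lc : ℂ) * rayPoint 0 φ r‖ -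
    Real.log ‖1 - rayPoint 0 φ r‖) +
  Real.cos φ * ((1 + (lc : ℂ) * rayPoint 0 φ r).arg - (1 - rayPoint 0 φ r).arg)

theorem hasDerivAt_im_f1 {lc Lam φ r : ℝ} (hlc : 0 ≤ lc) (hs : 0 < Real.sin φ)
    (hc : 0 ≤ Real.cos φ) (hr : 0 ≤ r) :
    HasDerivAt (fun r : ℝ => (f1 lc Lam (rayPoint 0 φ r)).im) (lc * radialSlope lc Lam φ r) r := by
  have h := (hasDerivAt_f1 (Lam := Lam) (one_sub_rayPoint_mem_slitPlane hs hr)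
    (one_add_mul_rayPoint_mem_slitPlane hlc hc hr)).comp r (hasDerivAt_rayPoint 0 φ r)
  have h2 := Complex.imCLM.hasFDerivAt.comp_hasDerivAt r h
  refine h2.congr_deriv ?_
  rw [Complex.imCLM_apply, mul_assoc, Complex.im_ofReal_mul, mul_comm Complex.I, Complex.mul_im,
    Complex.exp_ofReal_mul_I_re, Complex.exp_ofReal_mul_I_im]
  simp only [Complex.sub_re, Complex.sub_im, Complex.add_re, Complex.add_im, Complex.ofReal_re,
    Complex.ofReal_im, Complex.log_re, Complex.log_im, radialSlope]
  ring

theorem norm_sq_one_sub_rayPoint (φ r : ℝ) :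
    ‖1 - rayPoint 0 φ r‖ ^ 2 = 1 - 2 * r * Real.cos φ + r ^ 2 := by
  rw [← Complex.normSq_eq_norm_sq, Complex.normSq_apply]
  simp only [Complex.sub_re, Complex.sub_im, Complex.one_re, Complex.one_im, rayPoint_re,
    rayPoint_im]
  linear_combination r ^ 2 * Real.sin_sq_add_cos_sq φ

theorem norm_sq_one_add_mul_rayPoint (a φ r : ℝ) :
    ‖1 + (a : ℂ) * rayPoint 0 φ r‖ ^ 2 = 1 + 2 * a * r * Real.cos φ + a ^ 2 * r ^ 2 := by
  rw [← Complex.normSq_eq_norm_sq, Complex.normSq_apply]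
  simp only [Complex.add_re, Complex.add_im, Complex.one_re, Complex.one_im, rayPoint_re,
    rayPoint_im, Complex.re_ofReal_mul, Complex.im_ofReal_mul]
  linear_combination a ^ 2 * r ^ 2 * Real.sin_sq_add_cos_sq φ

/-- Here `|1-ζ| ≤ 1 ≤ |1+λ_c ζ|`, so the moduli help. The linear gain in `r` comes from `-arg(1-ζ) ≥
sin(-arg(1-ζ)) ≥ r sin φ`. -/
theorem radialSlope_ge_of_le_one {lc Lam φ r : ℝ} (hlc : 0 ≤ lc) (hs : 0 < Real.sin φ)
    (hc : 1 / 2 ≤ Real.cos φ) (hr : 0 ≤ r) (hr1 : r ≤ 1) :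
    Real.sin φ * Real.log (1 + Lam) + Real.sin φ * r / 2 ≤ radialSlope lc Lam φ r := by
  have hA := one_sub_rayPoint_mem_slitPlane hs hr
  have hA0 : 0 < ‖1 - rayPoint 0 φ r‖ := norm_pos_iff.2 (Complex.slitPlane_ne_zero hA)
  have hA1 : ‖1 - rayPoint 0 φ r‖ ≤ 1 := by
    refine (sq_le_one_iff₀ hA0.le).1 ?_
    rw [norm_sq_one_sub_rayPoint]
    nlinarith
  have hB1 : 1 ≤ ‖1 + (lc : ℂ) * rayPoint 0 φ r‖ := by
    refine (one_le_sq_iff₀ (norm_nonneg _)).1 ?_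
    rw [norm_sq_one_add_mul_rayPoint]
    have : 0 ≤ 2 * lc * r * Real.cos φ := by positivity
    nlinarith [sq_nonneg (lc * r)]
  have hlogA := Real.log_nonpos hA0.le hA1
  have hlogB := Real.log_nonneg hB1
  have hargB : 0 ≤ (1 + (lc : ℂ) * rayPoint 0 φ r).arg := by
    rw [Complex.arg_nonneg_iff, Complex.add_im, Complex.im_ofReal_mul, rayPoint_im,
      Complex.one_im, zero_add]
    positivity
  have hsin : Real.sin (1 - rayPoint 0 φ r).arg = -(r * Real.sin φ) / ‖1 - rayPoint 0 φ r‖ := by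
    rw [Complex.sin_arg, Complex.sub_im, rayPoint_im, Complex.one_im, zero_sub]
  have hargA0 : (1 - rayPoint 0 φ r).arg ≤ 0 := by
    rcases hr.eq_or_lt with rfl | hr
    · simp [rayPoint]
    · refine (Complex.arg_neg_iff.2 ?_).le
      rw [Complex.sub_im, rayPoint_im, Complex.one_im, zero_sub]
      exact neg_neg_of_pos (by positivity)
  have hargA : r * Real.sin φ ≤ -(1 - rayPoint 0 φ r).arg := by
    have h1 := Real.sin_le (neg_nonneg.2 hargA0)
    rw [Real.sin_neg, hsin, neg_div, neg_neg] at h1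
    refine le_trans ?_ h1
    rw [le_div_iff₀ hA0]
    exact mul_le_of_le_one_right (by positivity) hA1
  rw [radialSlope]
  have h2 : 0 ≤ Real.sin φ * (Real.log ‖1 + (lc : ℂ) * rayPoint 0 φ r‖ -
    Real.log ‖1 - rayPoint 0 φ r‖) := mul_nonneg hs.le (by linarith)
  have h3 : 1 / 2 * (r * Real.sin φ) ≤ Real.cos φ *
      ((1 + (lc : ℂ) * rayPoint 0 φ r).arg - (1 - rayPoint 0 φ r).arg) :=
    mul_le_mul hc (by linarith) (by positivity) (by linarith)
  linarith

/-- The moduli may now cost `sin φ · |ln λ_c|`, at most `cos φ / 4` by the choice of angle. Beyond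
`r = 1` one has `-arg(1-ζ) ≥ π/4`, which contributes at least `3/4 cos φ`. -/
theorem radialSlope_ge_of_one_le {lc Lam φ r : ℝ} (hlc : 0 < lc) (hlc1 : lc ≤ 1)
    (hs : 0 < Real.sin φ) (hc : 0 ≤ Real.cos φ) (hsc : Real.sin φ ≤ Real.cos φ)
    (hsl : Real.sin φ * (-Real.log lc) ≤ Real.cos φ / 4) (hr1 : 1 ≤ r) :
    Real.sin φ * Real.log (1 + Lam) + Real.sin φ / 2 ≤ radialSlope lc Lam φ r := by
  have hr : 0 < r := by linarith
  have hA := one_sub_rayPoint_mem_slitPlane hs hr.le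
  have hA0 : 0 < ‖1 - rayPoint 0 φ r‖ := norm_pos_iff.2 (Complex.slitPlane_ne_zero hA)
  have hAB : lc * ‖1 - rayPoint 0 φ r‖ ≤ ‖1 + (lc : ℂ) * rayPoint 0 φ r‖ := by
    refine (pow_le_pow_iff_left₀ (by positivity) (norm_nonneg _) two_ne_zero).1 ?_
    rw [mul_pow, norm_sq_one_sub_rayPoint, norm_sq_one_add_mul_rayPoint]
    have h1 : 0 ≤ 2 * lc * r * Real.cos φ := by positivity
    have h2 : 0 ≤ 2 * lc ^ 2 * r * Real.cos φ := by positivity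
    have h3 : lc ^ 2 ≤ 1 := by nlinarith
    nlinarith
  have hlog : Real.log lc ≤ Real.log ‖1 + (lc : ℂ) * rayPoint 0 φ r‖ -
      Real.log ‖1 - rayPoint 0 φ r‖ := by
    have := Real.log_le_log (by positivity) hAB
    rw [Real.log_mul hlc.ne' hA0.ne'] at this
    linarith
  have hargB : 0 ≤ (1 + (lc : ℂ) * rayPoint 0 φ r).arg := by
    rw [Complex.arg_nonneg_iff, Complex.add_im, Complex.im_ofReal_mul, rayPoint_im,
      Complex.one_im, zero_add]
    positivity
  have hargA : Real.pi / 4 ≤ -(1 - rayPoint 0 φ r).arg := by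
    by_contra hlt
    push Not at hlt
    have hpi := Real.pi_pos
    have hneg : (1 - rayPoint 0 φ r).arg < 0 := by
      refine Complex.arg_neg_iff.2 ?_
      rw [Complex.sub_im, rayPoint_im, Complex.one_im, zero_sub]
      exact neg_neg_of_pos (by positivity)
    have h1 := Real.sin_lt_sin_of_lt_of_le_pi_div_two (by linarith) (by linarith) hlt
    have h2 := Real.cos_lt_cos_of_nonneg_of_le_pi (by linarith) (by linarith) hlt
    rw [Real.cos_pi_div_four] at h2
    rw [Real.sin_pi_div_four] at h1
    rw [Real.sin_neg, Complex.sin_arg, Complex.sub_im, rayPoint_im, Complex.one_im, zero_sub,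
      neg_div, neg_neg] at h1
    rw [Real.cos_neg, Complex.cos_arg (Complex.slitPlane_ne_zero hA), Complex.sub_re, rayPoint_re,
      Complex.one_re] at h2
    have h3 := (div_lt_div_iff_of_pos_right hA0).1 (h1.trans h2)
    -- For `r ≥ 1` this gives `r sin φ ≥ 1 - r cos φ`, contradicting an argument of `1-ζ` above
    -- `-π/4`.
    have h4 : 1 ≤ Real.sin φ + Real.cos φ := by
      nlinarith [Real.sin_sq_add_cos_sq φ, mul_nonneg hs.le hc]
    nlinarith
  rw [radialSlope]
  have h2 := mul_le_mul_of_nonneg_left hlog hs.le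
  have h3 : Real.cos φ * (3 / 4) ≤ Real.cos φ *
      ((1 + (lc : ℂ) * rayPoint 0 φ r).arg - (1 - rayPoint 0 φ r).arg) :=
    mul_le_mul_of_nonneg_left (by linarith [Real.pi_gt_three]) hc
  linarith

theorem im_f1_ge_of_le_one {lc Lam φ r : ℝ} (hlc : 0 ≤ lc) (hs : 0 < Real.sin φ)
    (hc : 1 / 2 ≤ Real.cos φ) (hr : 0 ≤ r) (hr1 : r ≤ 1) :
    lc * (Real.sin φ * Real.log (1 + Lam) * r + Real.sin φ * r ^ 2 / 4) ≤
      (f1 lc Lam (rayPoint 0 φ r)).im := by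
  set u : ℝ → ℝ := fun r => (f1 lc Lam (rayPoint 0 φ r)).im -
    lc * (Real.sin φ * Real.log (1 + Lam) * r + Real.sin φ * r ^ 2 / 4) with hu
  have hd : ∀ x : ℝ, 0 ≤ x → HasDerivAt u (lc * radialSlope lc Lam φ x -
      lc * (Real.sin φ * Real.log (1 + Lam) + Real.sin φ * x / 2)) x := by
    intro x hx
    have h1 := ((hasDerivAt_id x).const_mul (Real.sin φ * Real.log (1 + Lam))).add
      (((hasDerivAt_pow 2 x).const_mul (Real.sin φ)).div_const 4)
    refine ((hasDerivAt_im_f1 hlc hs (by linarith) hx).sub (h1.const_mul lc)).congr_deriv ?_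
    push_cast
    ring
  have hmono : MonotoneOn u (Icc 0 1) := by
    refine monotoneOn_of_deriv_nonneg (convex_Icc 0 1)
      (fun x hx => (hd x hx.1).continuousAt.continuousWithinAt)
      (fun x hx => (hd x (interior_subset hx).1).differentiableAt.differentiableWithinAt)
      fun x hx => ?_
    have hx' := interior_subset hx
    rw [(hd x hx'.1).deriv, ← mul_sub]
    exact mul_nonneg hlc (sub_nonneg.2 (radialSlope_ge_of_le_one hlc hs hc hx'.1 hx'.2))
  have h := hmono ⟨le_rfl, zero_le_one⟩ ⟨hr, hr1⟩ hr
  have h0 : u 0 = 0 := by simp [hu, rayPoint, f1]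
  rw [h0, hu] at h
  linarith

theorem im_f1_ge_of_one_le {lc Lam φ r : ℝ} (hlc : 0 < lc) (hlc1 : lc ≤ 1)
    (hs : 0 < Real.sin φ) (hc : 1 / 2 ≤ Real.cos φ) (hsc : Real.sin φ ≤ Real.cos φ)
    (hsl : Real.sin φ * (-Real.log lc) ≤ Real.cos φ / 4) (hr1 : 1 ≤ r) :
    lc * (Real.sin φ * Real.log (1 + Lam) * r + Real.sin φ * r / 4) ≤
      (f1 lc Lam (rayPoint 0 φ r)).im := by
  have hd : ∀ x : ℝ, 1 ≤ x → HasDerivAt (fun r : ℝ => (f1 lc Lam (rayPoint 0 φ r)).im)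
      (lc * radialSlope lc Lam φ x) x := fun x hx =>
    hasDerivAt_im_f1 hlc.le hs (by linarith) (by linarith)
  have h := Convex.mul_sub_le_image_sub_of_le_deriv (convex_Ici (1 : ℝ))
    (fun x hx => (hd x hx).continuousAt.continuousWithinAt)
    (fun x hx => (hd x (interior_subset hx)).differentiableAt.differentiableWithinAt)
    (C := lc * (Real.sin φ * Real.log (1 + Lam) + Real.sin φ / 2)) (fun x hx => by
      rw [(hd x (interior_subset hx)).deriv]
      exact mul_le_mul_of_nonneg_left (radialSlope_ge_of_one_le hlc hlc1 hs (by linarith) hsc hsl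
        (interior_subset hx)) hlc.le) 1 (mem_Ici.2 le_rfl) r hr1 hr1
  have h1 := im_f1_ge_of_le_one (Lam := Lam) hlc.le hs hc zero_le_one le_rfl
  have h2 : 0 ≤ lc * Real.sin φ * (r - 1) := by
    have : 0 ≤ r - 1 := by linarith
    positivity
  nlinarith

/-! ### Local expansion and pointwise comparison with the model. -/

theorem norm_ampG_sub_one_le {δ σ t r φ : ℝ} (hσ0 : 1 / 2 ≤ σ) (hσ1 : σ < 1)
    (hlc : 0 ≤ lamC δ t) (hlc1 : lamC δ t ≤ 1) (hr : 0 ≤ r) (hr1 : r ≤ 1 / 2) :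
    ‖ampG δ σ t (rayPoint 0 φ r) - 1‖ ≤ 3 * r := by
  set ζ := rayPoint 0 φ r with hζ
  have hn : ‖ζ‖ = r := norm_rayPoint_zero φ hr
  have hlζ : ‖(lamC δ t : ℂ) * ζ‖ ≤ r := by
    rw [norm_mul, hn, Complex.norm_real, Real.norm_of_nonneg hlc]
    nlinarith
  have h1 : ‖Complex.log (1 - ζ)‖ ≤ 3 / 2 * r := by
    have := Complex.norm_log_one_add_half_le_self (z := -ζ) (by rw [norm_neg, hn]; exact hr1)
    rwa [norm_neg, hn, ← sub_eq_add_neg] at this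
  have h2 : ‖Complex.log (1 + (lamC δ t : ℂ) * ζ)‖ ≤ 3 / 2 * r := by
    have := Complex.norm_log_one_add_half_le_self (z := (lamC δ t : ℂ) * ζ) (hlζ.trans hr1)
    linarith
  have n1 : 1 - ζ ≠ 0 := fun h => by
    have : ‖ζ‖ = 1 := by rw [← sub_eq_zero.1 h, norm_one]
    linarith
  have n2 : 1 + (lamC δ t : ℂ) * ζ ≠ 0 := fun h => by
    have : ‖(lamC δ t : ℂ) * ζ‖ = 1 := by rw [← neg_eq_of_add_eq_zero_right h, norm_neg, norm_one]
    linarith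
  rw [ampG, Complex.cpow_def_of_ne_zero n1, Complex.cpow_def_of_ne_zero n2, ← Complex.exp_add]
  have h3 : ‖Complex.log (1 - ζ) * (-(1 / 2)) + Complex.log (1 + (lamC δ t : ℂ) * ζ) *
      ((σ : ℂ) - 1 / 2)‖ ≤ 3 / 2 * r := by
    refine (norm_add_le _ _).trans ?_
    have e2 : ((σ : ℂ) - 1 / 2) = ((σ - 1 / 2 : ℝ) : ℂ) := by push_cast; rfl
    rw [norm_mul, norm_mul, e2, Complex.norm_real, Real.norm_of_nonneg (by linarith)]
    have e3 : ‖(-(1 / 2) : ℂ)‖ = 1 / 2 := by simp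
    rw [e3]
    nlinarith [norm_nonneg (Complex.log (1 + (lamC δ t : ℂ) * ζ))]
  refine (Complex.norm_exp_sub_one_le (h3.trans (by linarith))).trans ?_
  linarith

/-- The linear terms of the two free logarithms cancel. Each of the four Taylor remainders carries a
factor `λ_c`, which is essential: multiplied by `t` the error is then `O(N |ζ|³)`. -/
theorem norm_f1_sub_quadratic_le {lc Lam : ℝ} (hlc : 0 ≤ lc) (hlc1 : lc ≤ 1) {ζ : ℂ}
    (hζ : ‖ζ‖ ≤ 1 / 2) :
    ‖f1 lc Lam ζ - (lc * Real.log (1 + Lam) * ζ + lc * (1 + lc) / 2 * ζ ^ 2)‖ ≤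
      4 * lc * ‖ζ‖ ^ 3 := by
  have hbound : ∀ z : ℂ, ‖z‖ ≤ 1 / 2 → ‖Complex.log (1 + z) - z‖ ≤ ‖z‖ ^ 2 ∧
      ‖Complex.log (1 + z) - (z - z ^ 2 / 2)‖ ≤ ‖z‖ ^ 3 := by
    intro z hz
    have hinv : (1 - ‖z‖)⁻¹ ≤ 2 := by
      rw [inv_le_comm₀ (by linarith) two_pos]; linarith
    have hn := norm_nonneg z
    constructor
    · refine (Complex.norm_log_one_add_sub_self_le (by linarith)).trans ?_
      nlinarith [mul_le_mul_of_nonneg_left hinv (sq_nonneg ‖z‖)]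
    · have h := Complex.norm_log_sub_logTaylor_le 2 (z := z) (by linarith)
      have ht : Complex.logTaylor (2 + 1) z = z - z ^ 2 / 2 := by
        simp [Complex.logTaylor, Finset.sum_range_succ]
        ring
      rw [ht] at h
      refine h.trans ?_
      norm_num
      nlinarith [mul_le_mul_of_nonneg_left hinv (pow_nonneg hn 3), pow_nonneg hn 3]
  have hlζ : ‖(lc : ℂ) * ζ‖ = lc * ‖ζ‖ := by
    rw [norm_mul, Complex.norm_real, Real.norm_of_nonneg hlc]
  have hn := norm_nonneg ζ
  have hlζ1 : lc * ‖ζ‖ ≤ 1 / 2 := by nlinarith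
  obtain ⟨a1, a2⟩ := hbound (lc * ζ) (by rw [hlζ]; exact hlζ1)
  obtain ⟨b1, b2⟩ := hbound (-ζ) (by rwa [norm_neg])
  rw [norm_neg, ← sub_eq_add_neg] at b1 b2
  rw [hlζ] at a1 a2
  set la := Complex.log (1 + lc * ζ)
  set lb := Complex.log (1 - ζ)
  have heq : f1 lc Lam ζ - (lc * Real.log (1 + Lam) * ζ + lc * (1 + lc) / 2 * ζ ^ 2) =
      (lc * ζ) * (la - lc * ζ) - (lc * ζ) * (lb - -ζ) + (la - (lc * ζ - (lc * ζ) ^ 2 / 2)) +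
        lc * (lb - (-ζ - (-ζ) ^ 2 / 2)) := by
    rw [f1]; ring
  rw [heq]
  have n1 : ‖(lc * ζ) * (la - lc * ζ)‖ ≤ lc * ‖ζ‖ ^ 3 := by
    rw [norm_mul, hlζ]
    have h4 : (lc * ‖ζ‖) ^ 2 ≤ ‖ζ‖ ^ 2 := by
      gcongr
      nlinarith
    have := mul_le_mul_of_nonneg_left (a1.trans h4) (show 0 ≤ lc * ‖ζ‖ by positivity)
    linarith
  have n2 : ‖(lc * ζ) * (lb - -ζ)‖ ≤ lc * ‖ζ‖ ^ 3 := by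
    rw [norm_mul, hlζ]
    have := mul_le_mul_of_nonneg_left b1 (show 0 ≤ lc * ‖ζ‖ by positivity)
    linarith
  have n3 : ‖la - (lc * ζ - (lc * ζ) ^ 2 / 2)‖ ≤ lc * ‖ζ‖ ^ 3 := by
    refine a2.trans ?_
    rw [mul_pow]
    gcongr
    exact pow_le_of_le_one hlc hlc1 (by norm_num)
  have n4 : ‖(lc : ℂ) * (lb - (-ζ - (-ζ) ^ 2 / 2))‖ ≤ lc * ‖ζ‖ ^ 3 := by
    rw [norm_mul, Complex.norm_real, Real.norm_of_nonneg hlc]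
    gcongr
  refine (norm_add_le _ _).trans ((add_le_add ((norm_add_le _ _).trans (add_le_add
    ((norm_sub_le _ _).trans (add_le_add n1 n2)) n3)) n4).trans ?_)
  linarith

theorem omega_nonneg {δ t Lam : ℝ} (hlc : 0 < lamC δ t) (hL : 0 ≤ Lam) : 0 ≤ omega δ t Lam := by
  have := Real.log_nonneg (show 1 ≤ 1 + Lam by linarith)
  unfold omega
  positivity

/-- The exponent of decay of the reduced integrand and of its quadratic model along a ray, where
`s` is the sine of the angle and `x` the rescaled distance. -/
noncomputable def decayRate (w s x : ℝ) : ℝ := 2 * w * s * x + s / 4 * (x - 1 / 4)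

theorem norm_exp_phaseH_le {δ t Lam φ r : ℝ} (hlc : 0 < lamC δ t) (hlc1 : lamC δ t ≤ 1)
    (hN : 1 ≤ lamC δ t * t / 2) (hs : 0 < Real.sin φ) (hc : 1 / 2 ≤ Real.cos φ)
    (hsc : Real.sin φ ≤ Real.cos φ)
    (hsl : Real.sin φ * (-Real.log (lamC δ t)) ≤ Real.cos φ / 4) (hr : 0 ≤ r) :
    Real.exp (-(t / (1 + lamC δ t) * (f1 (lamC δ t) Lam (rayPoint 0 φ r)).im)) ≤
      Real.exp (-decayRate (omega δ t Lam) (Real.sin φ) (Real.sqrt (lamC δ t * t / 2) * r)) := by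
  set l := lamC δ t with hl
  have ht : 0 < t := by
    by_contra h
    push Not at h
    nlinarith
  set n := Real.sqrt (l * t / 2) with hn
  have hn2 : n ^ 2 = l * t / 2 := Real.sq_sqrt (by linarith)
  have hn1 : 1 ≤ n := Real.one_le_sqrt.2 hN
  -- The phase grows quadratically up to `r = 1` and linearly beyond. The inequality `x² ≥ x - 1/4`
  -- puts both regimes under one linear rate, whence the shift in `decayRate`.
  obtain ⟨q, hq, hqle, hf⟩ : ∃ q : ℝ, 0 ≤ q ∧ n * r - 1 / 4 ≤ n ^ 2 * q ∧
      l * (Real.sin φ * Real.log (1 + Lam) * r + Real.sin φ * q / 4) ≤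
        (f1 l Lam (rayPoint 0 φ r)).im := by
    rcases le_total r 1 with h | h
    · exact ⟨r ^ 2, sq_nonneg r, by nlinarith [sq_nonneg (n * r - 1 / 2)],
        im_f1_ge_of_le_one hlc.le hs hc hr h⟩
    · refine ⟨r, hr, ?_, im_f1_ge_of_one_le hlc hlc1 hs hc hsc hsl h⟩
      have : n * r ≤ n ^ 2 * r := mul_le_mul_of_nonneg_right (by nlinarith) hr
      linarith
  gcongr
  have h1 := mul_le_mul_of_nonneg_left hf (show 0 ≤ t / (1 + l) by positivity)
  refine le_trans ?_ h1
  have h2 : t / (1 + l) * (l * (Real.sin φ * Real.log (1 + Lam) * r + Real.sin φ * q / 4)) =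
      2 * omega δ t Lam * Real.sin φ * (n * r) +
        2 / (1 + l) * (Real.sin φ / 4 * (n ^ 2 * q)) := by
    rw [omega, ← hl, ← hn]
    have e : 2 * (n * (Real.log (1 + Lam) / (1 + l))) * Real.sin φ * (n * r) =
        2 * n ^ 2 * (Real.log (1 + Lam) / (1 + l)) * Real.sin φ * r := by ring
    rw [e, hn2]
    field_simp
  have h3 : 1 ≤ 2 / (1 + l) := by rw [le_div_iff₀ (by positivity)]; linarith
  have h4 : Real.sin φ / 4 * (n ^ 2 * q) ≤ 2 / (1 + l) * (Real.sin φ / 4 * (n ^ 2 * q)) :=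
    le_mul_of_one_le_left (by positivity) h3
  have h5 := mul_le_mul_of_nonneg_left hqle (show 0 ≤ Real.sin φ / 4 by positivity)
  rw [h2, decayRate]
  linarith

theorem re_quadratic_le {N w φ r : ℝ} (hN : 0 ≤ N) (hs : 0 < Real.sin φ)
    (hc : 1 / 2 ≤ Real.cos φ) :
    (Complex.I * (N * rayPoint 0 φ r ^ 2 + 2 * Real.sqrt N * w * rayPoint 0 φ r)).re ≤
      -decayRate w (Real.sin φ) (Real.sqrt N * r) := by
  have hre : (Complex.I * (N * rayPoint 0 φ r ^ 2 + 2 * Real.sqrt N * w * rayPoint 0 φ r)).re =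
      -(N * (2 * (rayPoint 0 φ r).re * (rayPoint 0 φ r).im) +
        2 * Real.sqrt N * w * (rayPoint 0 φ r).im) := by
    rw [Complex.I_mul_re]
    simp only [sq, Complex.add_im, Complex.mul_im, Complex.mul_re, Complex.ofReal_re,
      Complex.ofReal_im, Complex.re_ofNat, Complex.im_ofNat]
    ring
  have hn2 : Real.sqrt N ^ 2 = N := Real.sq_sqrt hN
  rw [hre, rayPoint_re, rayPoint_im, decayRate]
  set x := Real.sqrt N * r with hx
  have e1 : N * (2 * (r * Real.cos φ) * (r * Real.sin φ)) =
      2 * Real.cos φ * (Real.sin φ * x ^ 2) := by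
    rw [hx, mul_pow, hn2]; ring
  have e2 : 2 * Real.sqrt N * w * (r * Real.sin φ) = 2 * w * Real.sin φ * x := by
    rw [hx]; ring
  rw [e1, e2]
  have h1 : Real.sin φ * x ^ 2 ≤ 2 * Real.cos φ * (Real.sin φ * x ^ 2) :=
    le_mul_of_one_le_left (by positivity) (by linarith)
  have h2 : Real.sin φ * ((x - 1 / 4) / 4) ≤ Real.sin φ * x ^ 2 :=
    mul_le_mul_of_nonneg_left (by nlinarith [sq_nonneg (x - 1 / 8)]) hs.le
  linarith

/-- Pointwise comparison of the reduced integrand with its quadratic model. -/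
theorem norm_integrandTilde_sub_quadratic_le {δ σ t Lam φ r : ℝ} (hσ0 : 1 / 2 ≤ σ)
    (hσ1 : σ < 1) (hlc : 0 < lamC δ t) (hlc1 : lamC δ t ≤ 1) (hN : 1 ≤ lamC δ t * t / 2)
    (hs : 0 < Real.sin φ) (hc : 1 / 2 ≤ Real.cos φ) (hsc : Real.sin φ ≤ Real.cos φ)
    (hsl : Real.sin φ * (-Real.log (lamC δ t)) ≤ Real.cos φ / 4) (hr : 0 ≤ r) :
    ‖integrandTilde δ σ t Lam (rayPoint 0 φ r) -
        Complex.exp (Complex.I * (((lamC δ t * t / 2 : ℝ) : ℂ) * rayPoint 0 φ r ^ 2 +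
          2 * Real.sqrt (lamC δ t * t / 2) * omega δ t Lam * rayPoint 0 φ r))‖ ≤
      1 / Real.sin φ * (5 * r + 8 * (lamC δ t * t / 2) * r ^ 3) *
        Real.exp (-decayRate (omega δ t Lam) (Real.sin φ)
          (Real.sqrt (lamC δ t * t / 2) * r)) := by
  have hE := norm_exp_phaseH_le (Lam := Lam) hlc hlc1 hN hs hc hsc hsl hr
  have hM := re_quadratic_le (w := omega δ t Lam) (r := r) (zero_le_one.trans hN) hs hc
  have hA := norm_ampG_le hσ0 hσ1 hlc hlc1 hs hr
  have hmod : (Complex.I * (t : ℂ) * phaseH δ t Lam (rayPoint 0 φ r)).re ≤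
      -decayRate (omega δ t Lam) (Real.sin φ) (Real.sqrt (lamC δ t * t / 2) * r) := by
    rw [← norm_exp_phaseH, Complex.norm_exp] at hE
    exact Real.exp_le_exp.1 hE
  rw [← norm_exp_phaseH] at hE
  set l := lamC δ t with hl
  have ht : 0 < t := by
    by_contra h
    push Not at h
    nlinarith
  set N := l * t / 2 with hNdef
  set n := Real.sqrt N with hn
  have hn2 : n ^ 2 = N := Real.sq_sqrt (by linarith)
  set ζ := rayPoint 0 φ r with hζ
  have hζn : ‖ζ‖ = r := norm_rayPoint_zero φ hr
  set D := Real.exp (-decayRate (omega δ t Lam) (Real.sin φ) (n * r)) with hD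
  have hD0 : 0 < D := Real.exp_pos _
  set q : ℂ := Complex.I * ((N : ℂ) * ζ ^ 2 + 2 * n * omega δ t Lam * ζ) with hq
  have hs1 := Real.sin_le_one φ
  have hinv : 1 ≤ 1 / Real.sin φ := by rw [le_div_iff₀ hs]; linarith
  have hMn : ‖Complex.exp q‖ ≤ D := by
    rw [Complex.norm_exp]; exact Real.exp_le_exp.2 hM
  rw [integrandTilde]
  rcases le_total r (1 / 2) with hr1 | hr1
  · have hA1 := norm_ampG_sub_one_le (φ := φ) hσ0 hσ1 hlc.le hlc1 hr hr1
    have hquad := norm_f1_sub_quadratic_le (Lam := Lam) hlc.le hlc1 (ζ := ζ) (hζn.trans_le hr1)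
    have hdiff : Complex.I * (t : ℂ) * phaseH δ t Lam ζ - q = Complex.I *
        (((t / (1 + l) : ℝ) : ℂ) * (f1 l Lam ζ -
          (l * Real.log (1 + Lam) * ζ + l * (1 + l) / 2 * ζ ^ 2))) := by
      have h1l : (1 + (l : ℂ)) ≠ 0 := by
        have : 1 + l ≠ 0 := by positivity
        exact_mod_cast this
      have hw : (n : ℂ) * (omega δ t Lam : ℂ) = N * Real.log (1 + Lam) / (1 + l) := by
        have : n * omega δ t Lam = N * Real.log (1 + Lam) / (1 + l) := by
          rw [omega, ← hl, ← hNdef, ← hn, ← hn2]; ring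
        exact_mod_cast this
      rw [hq, phaseH, ← hl, mul_assoc (2 : ℂ), hw, hNdef]
      push_cast
      field_simp
      ring
    have hdn : ‖Complex.I * (t : ℂ) * phaseH δ t Lam ζ - q‖ ≤ 8 * N * r ^ 3 := by
      rw [hdiff, norm_mul, Complex.norm_I, one_mul, norm_mul, Complex.norm_real,
        Real.norm_of_nonneg (by positivity)]
      rw [hζn] at hquad
      have h1 : t / (1 + l) ≤ t := div_le_self ht.le (by linarith)
      refine (mul_le_mul h1 hquad (norm_nonneg _) ht.le).trans (le_of_eq ?_)
      rw [hNdef]; ring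
    have hsplit : ampG δ σ t ζ * Complex.exp (Complex.I * (t : ℂ) * phaseH δ t Lam ζ) -
        Complex.exp q = (ampG δ σ t ζ - 1) * Complex.exp (Complex.I * (t : ℂ) * phaseH δ t Lam ζ) +
          (Complex.exp (Complex.I * (t : ℂ) * phaseH δ t Lam ζ) - Complex.exp q) := by ring
    rw [hsplit]
    have h2 : ‖(ampG δ σ t ζ - 1) * Complex.exp (Complex.I * (t : ℂ) * phaseH δ t Lam ζ)‖ ≤
        3 * r * D := by
      rw [norm_mul]
      exact mul_le_mul hA1 hE (norm_nonneg _) (by positivity)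
    have h3 := (norm_exp_sub_exp_le hmod hM).trans (mul_le_mul_of_nonneg_left hdn hD0.le)
    refine (norm_add_le _ _).trans ((add_le_add h2 h3).trans ?_)
    have h4 : 5 * r + 8 * N * r ^ 3 ≤ 1 / Real.sin φ * (5 * r + 8 * N * r ^ 3) :=
      le_mul_of_one_le_left (by positivity) hinv
    have h5 := mul_le_mul_of_nonneg_right h4 hD0.le
    have h6 : 0 ≤ r * D := by positivity
    linarith
  -- Away from the origin no cancellation is needed: `2 + r ≤ 5r` for `r ≥ 1/2`, which fixes the
  -- coefficient `5`.
  · refine (norm_sub_le _ _).trans ?_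
    rw [norm_mul]
    have h1 := mul_le_mul hA hE (norm_nonneg _) (by positivity)
    refine (add_le_add h1 hMn).trans ?_
    have h2 : 1 / Real.sin φ * (1 + r) + 1 ≤ 1 / Real.sin φ * (5 * r + 8 * N * r ^ 3) := by
      have h3 : 1 / Real.sin φ * (1 + r) + 1 / Real.sin φ * 1 ≤
          1 / Real.sin φ * (5 * r + 8 * N * r ^ 3) := by
        rw [← mul_add]
        refine mul_le_mul_of_nonneg_left ?_ (by positivity)
        have : 0 ≤ 8 * N * r ^ 3 := by positivity
        linarith
      linarith
    have h4 := mul_le_mul_of_nonneg_right h2 hD0.le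
    linarith

/-! ### Integrating the error. -/

/-- With `y = 2sx`, `(1+w) e^{-yw} ≤ 1 + 1/y`, so a factor `1/(1+w)` is gained at the price of a
pole at `x = 0`. The error bound vanishes there to first order and absorbs it. -/
theorem one_add_mul_exp_neg_decayRate_le {w s x : ℝ} (hw : 0 ≤ w) (hs : 0 < s) (hs1 : s ≤ 1)
    (hx : 0 < x) :
    (1 + w) * Real.exp (-decayRate w s x) ≤
      2 * (1 + 1 / (2 * s * x)) * Real.exp (-(s / 4 * x)) := by
  have h1 : Real.exp (-decayRate w s x) =
      Real.exp (-(2 * s * x * w)) * Real.exp (s / 16) * Real.exp (-(s / 4 * x)) := by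
    rw [← Real.exp_add, ← Real.exp_add, decayRate]
    congr 1; ring
  have h2 : Real.exp (s / 16) ≤ 2 := by
    have h3 : Real.exp (s / 16) ≤ Real.exp (Real.log 2) := by
      refine Real.exp_le_exp.2 ?_
      linarith [Real.log_two_gt_d9]
    rwa [Real.exp_log two_pos] at h3
  have h4 : (1 + w) * Real.exp (-(2 * s * x * w)) ≤ 1 + 1 / (2 * s * x) := by
    rw [Real.exp_neg, ← div_eq_mul_inv, div_le_iff₀ (Real.exp_pos _)]
    have h5 := Real.add_one_le_exp (2 * s * x * w)
    have h6 : (1 + 1 / (2 * s * x)) * (2 * s * x * w + 1) =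
        1 + w + (2 * s * x * w + 1 / (2 * s * x)) := by
      field_simp; ring
    have h7 := mul_le_mul_of_nonneg_left h5 (show 0 ≤ 1 + 1 / (2 * s * x) by positivity)
    have h8 : 0 ≤ 2 * s * x * w + 1 / (2 * s * x) := by positivity
    linarith
  rw [h1]
  calc (1 + w) * (Real.exp (-(2 * s * x * w)) * Real.exp (s / 16) * Real.exp (-(s / 4 * x)))
      = ((1 + w) * Real.exp (-(2 * s * x * w))) * Real.exp (s / 16) * Real.exp (-(s / 4 * x)) := by
        ring
    _ ≤ (1 + 1 / (2 * s * x)) * 2 * Real.exp (-(s / 4 * x)) := by gcongr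
    _ = _ := by ring

theorem integral_majorant_le {s : ℝ} (hs : 0 < s) (hs1 : s ≤ 1) :
    IntegrableOn (fun x : ℝ => (5 + 10 * x + 8 * x ^ 2 + 16 * x ^ 3) * Real.exp (-(s / 4 * x)))
      (Ioi 0) ∧
    ∫ x in Ioi (0 : ℝ), (5 + 10 * x + 8 * x ^ 2 + 16 * x ^ 3) * Real.exp (-(s / 4 * x)) ≤
      26000 / s ^ 4 := by
  have hb : 0 < s / 4 := by positivity
  obtain ⟨i0, v0⟩ := integral_pow_mul_exp_neg_mul_Ioi 0 hb
  obtain ⟨i1, v1⟩ := integral_pow_mul_exp_neg_mul_Ioi 1 hb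
  obtain ⟨i2, v2⟩ := integral_pow_mul_exp_neg_mul_Ioi 2 hb
  obtain ⟨i3, v3⟩ := integral_pow_mul_exp_neg_mul_Ioi 3 hb
  have heq : (fun x : ℝ => (5 + 10 * x + 8 * x ^ 2 + 16 * x ^ 3) * Real.exp (-(s / 4 * x))) =
      fun x : ℝ => ((5 * (x ^ 0 * Real.exp (-(s / 4 * x))) +
        10 * (x ^ 1 * Real.exp (-(s / 4 * x)))) + 8 * (x ^ 2 * Real.exp (-(s / 4 * x)))) +
        16 * (x ^ 3 * Real.exp (-(s / 4 * x))) := by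
    funext x; ring
  have j0 := i0.const_mul 5
  have j1 := i1.const_mul 10
  have j2 := i2.const_mul 8
  have j3 := i3.const_mul 16
  rw [heq]
  have k1 : Integrable (fun x : ℝ => 5 * (x ^ 0 * Real.exp (-(s / 4 * x))) +
      10 * (x ^ 1 * Real.exp (-(s / 4 * x)))) (volume.restrict (Ioi 0)) := j0.add j1
  have k2 : Integrable (fun x : ℝ => 5 * (x ^ 0 * Real.exp (-(s / 4 * x))) +
      10 * (x ^ 1 * Real.exp (-(s / 4 * x))) + 8 * (x ^ 2 * Real.exp (-(s / 4 * x))))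
      (volume.restrict (Ioi 0)) := k1.add j2
  refine ⟨k2.add j3, ?_⟩
  rw [integral_add k2 j3, integral_add k1 j2, integral_add j0 j1,
    integral_const_mul, integral_const_mul, integral_const_mul, integral_const_mul, v0, v1, v2, v3]
  simp only [Nat.factorial]
  push_cast
  rw [show 5 * (1 / (s / 4) ^ 1) + 10 * (1 / (s / 4) ^ 2) + 8 * (2 / (s / 4) ^ 3) +
      16 * (6 / (s / 4) ^ 4) =
      (20 * s ^ 3 + 160 * s ^ 2 + 1024 * s + 24576) / s ^ 4 by field_simp; ring]
  gcongr
  have h2 : s ^ 2 ≤ 1 := pow_le_one₀ hs.le hs1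
  have h3 : s ^ 3 ≤ 1 := pow_le_one₀ hs.le hs1
  linarith

/-- Quantitative comparison of the reduced integral with the leading term. -/
theorem norm_JBtilde_sub_leadingTerm_le {δ σ t Lam φ : ℝ} (hδ : δ < 1) (hσ0 : 1 / 2 ≤ σ)
    (hσ1 : σ < 1) (ht : 1 < t) (hlam : lamC δ t * (1 + Lam) ∈ lamRange δ t)
    (hφ : AdmissibleAngle (lamC δ t * (1 + Lam)) φ) (hφ4 : φ ≤ Real.pi / 4)
    (hN : 1 ≤ lamC δ t * t / 2) (hc : 1 / 2 ≤ Real.cos φ) (hsc : Real.sin φ ≤ Real.cos φ)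
    (hsl : Real.sin φ * (-Real.log (lamC δ t)) ≤ Real.cos φ / 4) :
    ‖JBtilde δ σ t Lam φ - leadingTerm δ t Lam‖ ≤
      1 / (Real.sqrt (lamC δ t * t / 2) * (1 + omega δ t Lam)) *
        (26000 / (Real.sin φ ^ 6 * Real.sqrt (lamC δ t * t / 2))) := by
  have hlc := lamC_pos hδ ht
  have hlc1 := lamC_le_one hδ ht hlam
  have hw := omega_nonneg (t := t) hlc (Lam_nonneg hδ ht hlam)
  have hs : 0 < Real.sin φ :=
    Real.sin_pos_of_pos_of_lt_pi hφ.mem_Ioo.1 (by linarith [Real.pi_pos])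
  have hs1 := Real.sin_le_one φ
  have hpt := fun (r : ℝ) (hr : 0 ≤ r) => norm_integrandTilde_sub_quadratic_le (Lam := Lam) hσ0 hσ1
    hlc hlc1 hN hs hc hsc hsl hr
  have hint := rayIntegrable_integrandTilde hδ hσ0 hσ1 ht hlam hφ
  obtain ⟨hqi, hqv⟩ := rayIntegral_quadratic (zero_lt_one.trans_le hN) hw hφ.mem_Ioo.1 hφ4
  have hlead : leadingTerm δ t Lam = ((1 / Real.sqrt (lamC δ t * t / 2) : ℝ) : ℂ) *
      (Complex.exp (-Complex.I * (omega δ t Lam : ℂ) ^ 2) * fresnel (omega δ t Lam)) := by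
    have : Real.sqrt (2 / (lamC δ t * t)) = 1 / Real.sqrt (lamC δ t * t / 2) := by
      rw [← Real.sqrt_one, ← Real.sqrt_div zero_le_one, one_div_div]
    rw [leadingTerm, this]; ring
  rw [hlead, ← hqv, JBtilde, rayIntegral, rayIntegral, ← integral_sub hint hqi]
  set N := lamC δ t * t / 2 with hNdef
  set n := Real.sqrt N with hn
  set w := omega δ t Lam with hwdef
  set s := Real.sin φ with hsdef
  have hn1 : 1 ≤ n := Real.one_le_sqrt.2 hN
  have hn0 : 0 < n := by linarith
  have hn2 : n ^ 2 = N := Real.sq_sqrt (by linarith)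
  obtain ⟨hPi, hPv⟩ := integral_majorant_le hs hs1
  -- With `x = n r`, this is the product of `5r + 8Nr³` and `2(1 + 1/(2sx))` after extracting `1/(s²
  -- n)` and bounding the remaining `s` by `1`.
  set P : ℝ → ℝ := fun x =>
    (5 + 10 * x + 8 * x ^ 2 + 16 * x ^ 3) * Real.exp (-(s / 4 * x)) with hP
  have hPn : IntegrableOn (fun r : ℝ => P (n * r)) (Ioi 0) := by
    have h := integrableOn_Ioi_comp_mul_left_iff P 0 hn0
    rw [mul_zero] at h
    exact h.2 hPi
  have hPnv : ∫ r in Ioi (0 : ℝ), P (n * r) = n⁻¹ * ∫ x in Ioi (0 : ℝ), P x := by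
    have h := integral_comp_mul_left_Ioi P 0 hn0
    rwa [mul_zero, smul_eq_mul] at h
  have hbound : ∀ r ∈ Ioi (0 : ℝ),
      ‖integrandTilde δ σ t Lam (rayPoint 0 φ r) * Complex.exp (Complex.I * (φ : ℂ)) -
        Complex.exp (Complex.I * ((N : ℂ) * rayPoint 0 φ r ^ 2 +
          2 * n * w * rayPoint 0 φ r)) * Complex.exp (Complex.I * (φ : ℂ))‖ ≤
      1 / (s ^ 2 * n * (1 + w)) * P (n * r) := by
    intro r hr
    have hr0 : 0 < r := hr
    rw [← sub_mul, norm_mul, norm_exp_I_mul, mul_one]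
    refine (hpt r hr0.le).trans ?_
    have h1 := one_add_mul_exp_neg_decayRate_le hw hs hs1 (mul_pos hn0 hr0)
    have h2 : Real.exp (-decayRate w s (n * r)) ≤
        1 / (1 + w) * (2 * (1 + 1 / (2 * s * (n * r))) * Real.exp (-(s / 4 * (n * r)))) := by
      rw [one_div_mul_eq_div, le_div_iff₀ (by positivity)]
      linarith
    refine (mul_le_mul_of_nonneg_left h2 (by positivity)).trans ?_
    have h3 : 1 / s * (5 * r + 8 * N * r ^ 3) * (1 / (1 + w) *
        (2 * (1 + 1 / (2 * s * (n * r))) * Real.exp (-(s / 4 * (n * r))))) =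
        1 / (s ^ 2 * n * (1 + w)) *
          ((s * (10 * (n * r) + 16 * (n * r) ^ 3) + (5 + 8 * (n * r) ^ 2)) *
            Real.exp (-(s / 4 * (n * r)))) := by
      rw [← hn2]
      field_simp
      ring
    rw [h3, hP]
    have h4 : s * (10 * (n * r) + 16 * (n * r) ^ 3) ≤ 10 * (n * r) + 16 * (n * r) ^ 3 :=
      mul_le_of_le_one_left (by positivity) hs1
    refine mul_le_mul_of_nonneg_left (mul_le_mul_of_nonneg_right ?_ (Real.exp_nonneg _))
      (by positivity)
    linarith
  refine (norm_integral_le_of_norm_le (hPn.const_mul (1 / (s ^ 2 * n * (1 + w))))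
    ((ae_restrict_mem measurableSet_Ioi).mono hbound)).trans ?_
  rw [integral_const_mul, hPnv]
  have h5 : 1 / (n * (1 + w)) * (26000 / (s ^ 6 * n)) =
      1 / (s ^ 2 * n * (1 + w)) * (n⁻¹ * (26000 / s ^ 4)) := by
    field_simp
  rw [h5]
  gcongr

/-! ### The uniform angle and the uniform asymptotics. -/

/-- A direction, admissible for every `λ` of the range, along which the integrand decays. -/
theorem exists_uniform_angle {l : ℝ} (hl0 : 0 < l) (hl : l ≤ Real.exp (-1)) :
    ∃ φ : ℝ, φ ≤ Real.pi / 4 ∧ 1 / 2 ≤ Real.cos φ ∧ Real.sin φ ≤ Real.cos φ ∧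
      Real.sin φ * (-Real.log l) ≤ Real.cos φ / 4 ∧ 1 / (8 * -Real.log l) ≤ Real.sin φ ∧
      ∀ lam : ℝ, l ≤ lam → AdmissibleAngle lam φ := by
  have hpi := Real.pi_pos
  set b := -Real.log l with hb
  have hb1 : 1 ≤ b := by
    have := Real.log_le_log hl0 hl
    rw [Real.log_exp] at this
    linarith
  -- The tangent of the angle: `x b = 1/4` is exactly the requirement `sin φ · |ln λ_c| ≤ cos φ /
  -- 4`.
  set x := 1 / (4 * b) with hx
  have hx0 : 0 < x := by positivity
  have hx4 : x ≤ 1 / 4 := by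
    rw [hx, div_le_div_iff₀ (by positivity) (by norm_num)]; linarith
  have hcx := Real.cos_arctan x
  have hsx : Real.sin (Real.arctan x) = x * Real.cos (Real.arctan x) := by
    rw [Real.sin_arctan, Real.cos_arctan]; ring
  have hc : 1 / 2 ≤ Real.cos (Real.arctan x) := by
    rw [hcx]
    refine one_div_le_one_div_of_le (by positivity) ?_
    rw [Real.sqrt_le_left two_pos.le]
    nlinarith
  have hxb : x * b = 1 / 4 := by rw [hx]; field_simp
  refine ⟨Real.arctan x, ?_, hc, ?_, ?_, ?_, ?_⟩
  · rw [← Real.arctan_one]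
    exact Real.arctan_strictMono.monotone (by linarith)
  · rw [hsx]
    exact mul_le_of_le_one_left (by linarith) (by linarith)
  · rw [hsx, mul_right_comm, hxb]
    linarith
  · rw [hsx]
    have : 1 / (8 * b) = x * (1 / 2) := by rw [hx]; field_simp; norm_num
    rw [this]
    exact mul_le_mul_of_nonneg_left hc hx0.le
  · intro lam hlam
    have h0 : 0 < Real.arctan x := Real.arctan_pos.2 hx0
    rcases le_or_gt 0 (Real.log lam) with h | h
    · exact Or.inl ⟨h, h0, Real.arctan_lt_pi_div_two x⟩
    · refine Or.inr ⟨h, h0, Real.arctan_strictMono ?_⟩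
      have h1 : |Real.log lam| ≤ b := by
        rw [abs_of_neg h]
        linarith [Real.log_le_log hl0 hlam]
      rw [hx, div_lt_div_iff₀ (by positivity) (abs_pos.2 h.ne)]
      nlinarith [Real.pi_gt_three]

theorem rpow_sub_one_le_lamC {δ t : ℝ} (hδ : δ < 1) (ht : 1 < t) : t ^ (δ - 1) ≤ lamC δ t := by
  obtain ⟨h0, h1⟩ := rpow_sub_one_mem hδ ht
  rw [lamC, le_div_iff₀ (by linarith)]
  nlinarith

theorem tendsto_lamC {δ : ℝ} (hδ : δ < 1) : Tendsto (lamC δ) atTop (𝓝 0) := by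
  have h : Tendsto (fun t : ℝ => t ^ (δ - 1)) atTop (𝓝 0) := by
    have := tendsto_rpow_neg_atTop (y := 1 - δ) (by linarith)
    simpa using this
  have h2 := h.div (tendsto_const_nhds (x := (1 : ℝ)).sub h) (by norm_num)
  rw [sub_zero, zero_div] at h2
  exact h2

/-- The reduced integral is asymptotic to the leading term, uniformly. -/
theorem eventually_JBtilde_eq_leadingTerm_mul {δ σ : ℝ} (hδ0 : 0 < δ) (hδ : δ < 1)
    (hσ0 : 1 / 2 ≤ σ) (hσ1 : σ < 1) {η : ℝ} (hη : 0 < η) :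
    ∀ᶠ t : ℝ in atTop, ∀ Lam : ℝ, lamC δ t * (1 + Lam) ∈ lamRange δ t →
      ∀ φ : ℝ, AdmissibleAngle (lamC δ t * (1 + Lam)) φ →
        ∃ e : ℂ, ‖e‖ ≤ η ∧ JBtilde δ σ t Lam φ = leadingTerm δ t Lam * (1 + e) := by
  obtain ⟨c, hc0, hc⟩ := exists_norm_fresnel_ge
  -- In the constant, `8^6` comes from `1/sin φ ≤ 8 ln t` and the `2` from `√N ≥ t^{δ/2}/2`.
  have hsmall : ∀ᶠ t : ℝ in atTop,
      Real.log t ^ (6 : ℝ) ≤ c * η / (2 * 26000 * 8 ^ 6) * t ^ (δ / 2) := by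
    have h := (isLittleO_log_rpow_rpow_atTop 6 (show 0 < δ / 2 by positivity)).bound
      (show 0 < c * η / (2 * 26000 * 8 ^ 6) by positivity)
    filter_upwards [h, eventually_gt_atTop 1] with t h1 ht
    rwa [Real.norm_of_nonneg (Real.rpow_nonneg (Real.log_nonneg ht.le) _),
      Real.norm_of_nonneg (Real.rpow_nonneg (by linarith) _)] at h1
  filter_upwards [hsmall, eventually_gt_atTop 1,
    (tendsto_lamC hδ).eventually_le_const (Real.exp_pos (-1)),
    (tendsto_rpow_atTop hδ0).eventually_ge_atTop 2] with t hlog ht hlexp hδt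
  intro Lam hlam φ₁ hφ₁
  have ht0 : 0 < t := by linarith
  have hlc := lamC_pos hδ ht
  have hw := omega_nonneg (t := t) hlc (Lam_nonneg hδ ht hlam)
  obtain ⟨φ, hφ4, hcos, hsc, hsl, hsge, hadm⟩ := exists_uniform_angle hlc hlexp
  have hφ := hadm _ hlam.1
  have hge := rpow_sub_one_le_lamC hδ ht
  have htδ : t ^ δ ≤ lamC δ t * t := by
    have : t ^ δ = t ^ (δ - 1) * t := by
      rw [Real.rpow_sub_one ht0.ne']; field_simp
    rw [this]
    exact mul_le_mul_of_nonneg_right hge ht0.le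
  have hN : 1 ≤ lamC δ t * t / 2 := by linarith
  rw [JBtilde_eq_of_admissible hδ hσ0 hσ1 ht hlam hφ₁ hφ]
  have hmain := norm_JBtilde_sub_leadingTerm_le hδ hσ0 hσ1 ht hlam hφ hφ4 hN hcos hsc hsl
  have hsqrt : t ^ (δ / 2) / 2 ≤ Real.sqrt (lamC δ t * t / 2) := by
    refine Real.le_sqrt_of_sq_le ?_
    have : (t ^ (δ / 2)) ^ 2 = t ^ δ := by
      rw [← Real.rpow_natCast, ← Real.rpow_mul ht0.le]; congr 1; push_cast; ring
    rw [div_pow, this]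
    have := Real.rpow_nonneg ht0.le δ
    linarith
  have hlogl : -Real.log (lamC δ t) ≤ Real.log t := by
    have h1 := Real.log_le_log (rpow_sub_one_mem hδ ht).1 hge
    rw [Real.log_rpow ht0] at h1
    have := mul_nonneg hδ0.le (Real.log_nonneg ht.le)
    linarith
  have hlogl0 : 0 < -Real.log (lamC δ t) := by
    have := Real.log_le_log hlc hlexp
    rw [Real.log_exp] at this
    linarith
  have hlogt : 0 < Real.log t := hlogl0.trans_le hlogl
  have hs0 : 0 < Real.sin φ := lt_of_lt_of_le (by positivity) hsge
  have hs6 : 1 / Real.sin φ ^ 6 ≤ 8 ^ 6 * Real.log t ^ 6 := by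
    have h1 : 1 / (8 * Real.log t) ≤ Real.sin φ :=
      (one_div_le_one_div_of_le (by positivity) (by linarith)).trans hsge
    have h2 : 1 / Real.sin φ ≤ 8 * Real.log t := by
      rw [one_div_le hs0 (by positivity)]; exact h1
    have h3 := pow_le_pow_left₀ (by positivity) h2 6
    rwa [div_pow, one_pow, mul_pow] at h3
  set n := Real.sqrt (lamC δ t * t / 2) with hn
  have hn0 : 0 < n := by
    rw [hn]; exact Real.sqrt_pos.2 (by linarith)
  have herr : 26000 / (Real.sin φ ^ 6 * n) ≤ c * η := by
    rw [show (6 : ℝ) = ((6 : ℕ) : ℝ) by norm_num, Real.rpow_natCast] at hlog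
    rw [← div_div, div_le_iff₀ hn0]
    have h1 := mul_le_mul_of_nonneg_left hs6 (show (0 : ℝ) ≤ 26000 by norm_num)
    have h2 := mul_le_mul_of_nonneg_left hlog (show (0 : ℝ) ≤ 26000 * 8 ^ 6 by norm_num)
    have h3 := mul_le_mul_of_nonneg_left hsqrt (show 0 ≤ c * η by positivity)
    have h4 : 26000 * 8 ^ 6 * (c * η / (2 * 26000 * 8 ^ 6) * t ^ (δ / 2)) =
        c * η * (t ^ (δ / 2) / 2) := by ring
    rw [h4] at h2
    have h5 : 26000 / Real.sin φ ^ 6 = 26000 * (1 / Real.sin φ ^ 6) := by ring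
    rw [h5]
    linarith
  have hleadn : c / (n * (1 + omega δ t Lam)) ≤ ‖leadingTerm δ t Lam‖ := by
    have h1 := hc _ hw
    have h2 : Real.sqrt (2 / (lamC δ t * t)) = 1 / n := by
      rw [hn, ← Real.sqrt_one, ← Real.sqrt_div zero_le_one, one_div_div]
    have h3 : ‖Complex.exp (-Complex.I * (omega δ t Lam : ℂ) ^ 2)‖ = 1 := by
      rw [neg_mul, Complex.exp_neg, norm_inv, norm_exp_I_mul_sq, inv_one]
    rw [leadingTerm, norm_mul, norm_mul, h3, h2, Complex.norm_real,
      Real.norm_of_nonneg (by positivity), one_mul]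
    have h4 := mul_le_mul_of_nonneg_left h1 (show 0 ≤ 1 / n by positivity)
    refine le_trans (le_of_eq ?_) h4
    field_simp
  have hlead0 : 0 < ‖leadingTerm δ t Lam‖ := lt_of_lt_of_le (by positivity) hleadn
  have hne : leadingTerm δ t Lam ≠ 0 := norm_pos_iff.1 hlead0
  refine ⟨(JBtilde δ σ t Lam φ - leadingTerm δ t Lam) / leadingTerm δ t Lam, ?_, ?_⟩
  · rw [norm_div, div_le_iff₀ hlead0]
    refine hmain.trans ?_
    have h1 := mul_le_mul_of_nonneg_left hleadn hη.le
    have h2 := mul_le_mul_of_nonneg_left herr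
      (show 0 ≤ 1 / (n * (1 + omega δ t Lam)) by positivity)
    refine h2.trans (le_trans (le_of_eq ?_) h1)
    field_simp
  · field_simp
    ring

end UniformJB

theorem theorem1 (δ σ : ℝ) (hδ0 : 0 < δ) (hδ1 : δ < 1) (hσ0 : 1 / 2 ≤ σ) (hσ1 : σ < 1) :
    -- all the integrals converge absolutely
    (∀ t : ℝ, 1 < t → ∀ Lam : ℝ, lamC δ t * (1 + Lam) ∈ lamRange δ t →
      ∀ φ : ℝ, AdmissibleAngle (lamC δ t * (1 + Lam)) φ →
        RayIntegrable (integrandJB σ t (lamC δ t * (1 + Lam)))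
          ((1 - t ^ (δ - 1) : ℝ) : ℂ) φ ∧
        RayIntegrable (integrandTilde δ σ t Lam) 0 φ) ∧
    (∀ w : ℝ, 0 ≤ w → RayIntegrable fresnelIntegrand (w : ℂ) (Real.pi / 4)) ∧
    -- the exact relation between the integral and the reduced integral
    (∀ t : ℝ, 1 < t → ∀ Lam : ℝ, lamC δ t * (1 + Lam) ∈ lamRange δ t →
      ∀ φ : ℝ, AdmissibleAngle (lamC δ t * (1 + Lam)) φ →
        JB δ σ t (lamC δ t * (1 + Lam)) φ = prefactor δ σ t Lam * JBtilde δ σ t Lam φ) ∧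
    -- nonnegativity of `ω`
    (∀ t : ℝ, 1 < t → ∀ Lam : ℝ, lamC δ t * (1 + Lam) ∈ lamRange δ t → 0 ≤ omega δ t Lam) ∧
    -- leading-order asymptotics, uniformly over the whole range
    (∀ η : ℝ, 0 < η → ∃ T : ℝ, 1 < T ∧ ∀ t : ℝ, T ≤ t →
      ∀ Lam : ℝ, lamC δ t * (1 + Lam) ∈ lamRange δ t →
      ∀ φ : ℝ, AdmissibleAngle (lamC δ t * (1 + Lam)) φ →
        ∃ e : ℂ, ‖e‖ ≤ η ∧
          JBtilde δ σ t Lam φ = leadingTerm δ t Lam * (1 + e) ∧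
          JB δ σ t (lamC δ t * (1 + Lam)) φ =
            prefactor δ σ t Lam * (leadingTerm δ t Lam * (1 + e))) ∧
    -- the Fresnel integral is bounded, uniformly in `t` and `Λ` (in particular when `ω = O(1)`)
    (∃ C : ℝ, ∀ t : ℝ, 1 < t → ∀ Lam : ℝ, lamC δ t * (1 + Lam) ∈ lamRange δ t →
      ‖fresnel (omega δ t Lam)‖ ≤ C) ∧
    -- the regime of large `ω`: the Fresnel factor and the resulting form of the asymptotics
    (∃ C W : ℝ, 0 < W ∧
      (∀ t : ℝ, 1 < t → ∀ Lam : ℝ, lamC δ t * (1 + Lam) ∈ lamRange δ t →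
        W ≤ omega δ t Lam →
          ‖Complex.exp (-Complex.I * (omega δ t Lam : ℂ) ^ 2) * fresnel (omega δ t Lam)
              - (-1 / (2 * Complex.I * (omega δ t Lam : ℂ)))‖ ≤ C / omega δ t Lam ^ 3) ∧
      (∀ η : ℝ, 0 < η → ∃ T : ℝ, 1 < T ∧ ∀ t : ℝ, T ≤ t →
        ∀ Lam : ℝ, lamC δ t * (1 + Lam) ∈ lamRange δ t → W ≤ omega δ t Lam →
        ∀ φ : ℝ, AdmissibleAngle (lamC δ t * (1 + Lam)) φ →
          ∃ r e : ℂ, ‖r‖ ≤ C / omega δ t Lam ^ 3 ∧ ‖e‖ ≤ η ∧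
            JBtilde δ σ t Lam φ =
              (Real.sqrt (2 / (lamC δ t * t)) : ℂ) *
                (-1 / (2 * Complex.I * (omega δ t Lam : ℂ)) + r) * (1 + e))) := by
  have hex : ∀ η : ℝ, 0 < η → ∃ T : ℝ, 1 < T ∧ ∀ t : ℝ, T ≤ t →
      ∀ Lam : ℝ, lamC δ t * (1 + Lam) ∈ lamRange δ t →
      ∀ φ : ℝ, AdmissibleAngle (lamC δ t * (1 + Lam)) φ →
        ∃ e : ℂ, ‖e‖ ≤ η ∧ JBtilde δ σ t Lam φ = leadingTerm δ t Lam * (1 + e) := by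
    intro η hη
    obtain ⟨T, hT⟩ := Filter.eventually_atTop.1
      (eventually_JBtilde_eq_leadingTerm_mul hδ0 hδ1 hσ0 hσ1 hη)
    exact ⟨max T 2, lt_max_of_lt_right one_lt_two, fun t ht => hT t ((le_max_left _ _).trans ht)⟩
  have homega : ∀ t : ℝ, 1 < t → ∀ Lam : ℝ, lamC δ t * (1 + Lam) ∈ lamRange δ t →
      0 ≤ omega δ t Lam := fun t ht Lam hlam =>
    omega_nonneg (lamC_pos hδ1 ht) (Lam_nonneg hδ1 ht hlam)
  refine ⟨fun t ht Lam hlam φ hφ => ⟨rayIntegrable_integrandJB hδ1 hσ0 hσ1 ht hlam hφ,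
      rayIntegrable_integrandTilde hδ1 hσ0 hσ1 ht hlam hφ⟩,
    fun w hw => rayIntegrable_fresnel hw,
    fun t ht Lam hlam φ hφ => JB_eq_prefactor_mul hδ1 ht hlam hφ, homega, fun η hη => ?_,
    ⟨Real.sqrt Real.pi / 2, fun t ht Lam hlam => norm_fresnel_le (homega t ht Lam hlam)⟩,
    1, 1, one_pos, fun t _ Lam _ hW => norm_exp_mul_fresnel_sub_le (one_pos.trans_le hW),
    fun η hη => ?_⟩
  · obtain ⟨T, hT1, hT⟩ := hex η hη
    refine ⟨T, hT1, fun t ht Lam hlam φ hφ => ?_⟩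
    obtain ⟨e, he, hJ⟩ := hT t ht Lam hlam φ hφ
    refine ⟨e, he, hJ, ?_⟩
    rw [JB_eq_prefactor_mul hδ1 (hT1.trans_le ht) hlam hφ, hJ]
  · obtain ⟨T, hT1, hT⟩ := hex η hη
    refine ⟨T, hT1, fun t ht Lam hlam hW φ hφ => ?_⟩
    obtain ⟨e, he, hJ⟩ := hT t ht Lam hlam φ hφ
    -- Taking `r` to be the exact Fresnel remainder keeps the factor `1 + e` of the general
    -- asymptotics unchanged.
    refine ⟨_, e, norm_exp_mul_fresnel_sub_le (one_pos.trans_le hW), he, ?_⟩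
    rw [hJ, leadingTerm]
    ring
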